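/- For $n\in\mathbb N=\{1,2,\dots\}$ let $X_1,\dots,X_{n+1}$ be independent standard normal random points in $\mathbb R^n$ (density $(2\pi)^{-n/2}e^{-|x|^2/2}$), let $\mathcal V_{n,n}$ be the volume of the simplex with vertices $X_1,\dots,X_{n+1}$, and let $\mathcal L_{n,n}=\log(n!\,\mathcal V_{n,n})$. Put $$m_n=\tfrac12\Big(n\log n-n+\tfrac12\log n+\log(2^{3/2}\pi)\Big),\qquad w_n=\tfrac12\log\tfrac n2,\qquad \psi(t)=\frac{G(\frac12)}{G(\frac12+\frac t2)\,G(1+\frac t2)},$$ where $G$ is the Barnes $G$-function, $$G(1+z)=(2\pi)^{z/2}e^{-\frac12(z+(1+\gamma)z^2)}\prod_{k=1}^\infty\Big(1+\frac zk\Big)^k e^{\frac{z^2}{2k}-z}$$ with $\gamma$ the Euler constant. (i) The sequence $\mathcal L_{n,n}-m_n$ converges in the mod-Gaussian sense on the half-plane $\{\operatorname{Re}t>-1\}$ with parameters $w_n$ and limit function $\psi$. That is, $w_n\to+\infty$; $\mathbb E|e^{t(\mathcal L_{n,n}-m_n)}|<\infty$ for all $n\ge 1$ and $\operatorname{Re}t>-1$;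 $\psi$ is analytic on this half-plane; and, with $\eta(t)=\frac12t^2$ (so that $e^{\eta}$ is the moment generating function of the standard normal distribution), $$\lim_{n\to\infty}\frac{\mathbb E\,e^{t(\mathcal L_{n,n}-m_n)}}{e^{w_n\eta(t)}}=\lim_{n\to\infty}\frac{\mathbb E\,e^{t(\mathcal L_{n,n}-m_n)}}{e^{\frac14t^2\log\frac n2}}=\psi(t)$$ uniformly on every compact subset of $\{\operatorname{Re}t>-1\}$. (ii) The function $\psi$ is analytic on $\mathbb C\setminus\{-1,-2,\dots\}$. For every $n\ge1$ the moment generating function $t\mapsto\mathbb E\,e^{t(\mathcal L_{n,n}-m_n)}$, $\operatorname{Re}t>-1$, has a (necessarily unique) meromorphic continuation $M_n$ to $\mathbb C$ that is analytic on $\mathbb C\setminus\{-1,-2,\dots\}$, and $$\lim_{n\to\infty}\frac{M_n(t)}{e^{\frac14t^2\log\frac n2}}=\psi(t)$$ uniformly on every compact subset of $\mathbb C\setminus\{-1,-2,\dots\}$. -/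

import Mathlib

open MeasureTheory ProbabilityTheory Filter Set

noncomputable section

/-- The Barnes `G`-function: with `u = z - 1`, the Weierstrass product
`G(1 + u) = (2π)^(u/2) exp(-(u + (1 + γ) u²)/2) ∏_{k ≥ 1} (1 + u/k)^k exp(u²/(2k) - u)`. -/
def barnesG (z : ℂ) : ℂ :=
  (2 * Real.pi : ℂ) ^ ((z - 1) / 2) *
    Complex.exp (-((z - 1) + (1 + (Real.eulerMascheroniConstant : ℂ)) * (z - 1) ^ 2) / 2) *
    ∏' k : ℕ, ((1 + (z - 1) / ((k : ℂ) + 1)) ^ (k + 1) *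
      Complex.exp ((z - 1) ^ 2 / (2 * ((k : ℂ) + 1)) - (z - 1)))

/-- A probability measure on `ℝ` is infinitely divisible if for every `m ≥ 1` it is the law of a
sum of `m` independent identically distributed random variables. -/
def IsInfinitelyDivisible (φ : Measure ℝ) : Prop :=
  IsProbabilityMeasure φ ∧
    ∀ m : ℕ, 1 ≤ m → ∃ ν : Measure ℝ, IsProbabilityMeasure ν ∧
      Measure.map (fun x : Fin m → ℝ => ∑ i, x i) (Measure.pi fun _ => ν) = φ

/-- The open vertical strip `{t ∈ ℂ : a < Re t < b}`, where `-∞ ≤ a, b ≤ ∞`. -/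
def verticalStrip (a b : EReal) : Set ℂ :=
  {t : ℂ | a < ((t.re : ℝ) : EReal) ∧ ((t.re : ℝ) : EReal) < b}

/-- Mod-`φ` convergence of the sequence of random variables `(X n)_{n ≥ 1}`, where `X n` is defined
on the probability space `(Ω n, P n)`, on the strip `a < Re t < b`, with parameters `w n` and limit
function `ψ`. Here `φ` is an infinitely divisible distribution with moment generating function
`exp (η t)`. -/
structure ModPhiConvergence {Ω : ℕ → Type*} [∀ n, MeasurableSpace (Ω n)] (P : ∀ n, Measure (Ω n))
    (X : ∀ n, Ω n → ℝ) (φ : Measure ℝ) (η : ℂ → ℂ) (a b : EReal) (w : ℕ → ℝ) (ψ : ℂ → ℂ) :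
    Prop where
  lt : a < b
  infinitelyDivisible : IsInfinitelyDivisible φ
  integrable_phi : ∀ t ∈ verticalStrip a b, Integrable (fun x : ℝ => Complex.exp (t * x)) φ
  mgf_phi : ∀ t ∈ verticalStrip a b, ∫ x : ℝ, Complex.exp (t * x) ∂φ = Complex.exp (η t)
  aemeasurable : ∀ n, 1 ≤ n → AEMeasurable (X n) (P n)
  integrable : ∀ n, 1 ≤ n → ∀ t ∈ verticalStrip a b,
    Integrable (fun ω => Complex.exp (t * X n ω)) (P n)
  tendsto_param : Tendsto w atTop atTop
  analytic : AnalyticOnNhd ℂ ψ (verticalStrip a b)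
  tendsto : ∀ K : Set ℂ, IsCompact K → K ⊆ verticalStrip a b →
    TendstoUniformlyOn
      (fun n t => (∫ ω, Complex.exp (t * X n ω) ∂(P n)) / Complex.exp (w n * η t)) ψ atTop K

/-- Mod-Gaussian convergence: `φ` is the standard normal distribution and `η t = t² / 2`. -/
def ModGaussianConvergence {Ω : ℕ → Type*} [∀ n, MeasurableSpace (Ω n)] (P : ∀ n, Measure (Ω n))
    (X : ∀ n, Ω n → ℝ) (a b : EReal) (w : ℕ → ℝ) (ψ : ℂ → ℂ) : Prop :=
  ModPhiConvergence P X (gaussianReal 0 1) (fun t => t ^ 2 / 2) a b w ψ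

/-- The Gaussian model with `n + 1` points: `X 0, …, X n` are independent standard normal random
points in `ℝⁿ`. -/
structure IsGaussianModel {Ω : Type*} [MeasurableSpace Ω] (P : Measure Ω) {n : ℕ}
    (X : Fin (n + 1) → Ω → EuclideanSpace ℝ (Fin n)) : Prop where
  hasLaw : ∀ i, HasLaw (X i) (stdGaussian (EuclideanSpace ℝ (Fin n))) P
  indep : iIndepFun X P

/-- The volume of the full-dimensional simplex in `ℝⁿ` with vertices `x 0, …, x n`. -/
def simplexVolume {n : ℕ} (x : Fin (n + 1) → EuclideanSpace ℝ (Fin n)) : ℝ :=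
  (volume (convexHull ℝ (Set.range x))).toReal

/-- `log (n! V)`, where `V` is the volume of the random simplex with vertices `X 0, …, X n`. -/
def logSimplexVolume {Ω : Type*} {n : ℕ} (X : Fin (n + 1) → Ω → EuclideanSpace ℝ (Fin n)) (ω : Ω) :
    ℝ :=
  Real.log ((n.factorial : ℝ) * simplexVolume (fun i => X i ω))

/-- The centering `m_n = (n log n - n + (log n) / 2 + log (2^(3/2) π)) / 2`. -/
def fullDimCentering (n : ℕ) : ℝ :=
  (1 / 2) * ((n : ℝ) * Real.log n - n + (1 / 2) * Real.log n
    + Real.log ((2 : ℝ) ^ ((3 : ℝ) / 2) * Real.pi))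

/-- The parameters `w_n = (1/2) log (n/2)`. -/
def fullDimParam (n : ℕ) : ℝ := (1 / 2) * Real.log ((n : ℝ) / 2)

/-- The limit function `G(1/2) / (G(1/2 + t/2) G(1 + t/2))`. -/
def fullDimLimit (t : ℂ) : ℂ :=
  barnesG (1 / 2) / (barnesG (1 / 2 + t / 2) * barnesG (1 + t / 2))

/-- The domain `ℂ ∖ {-1, -2, …}`. -/
def complNegIntegers : Set ℂ := {t : ℂ | ∀ k : ℕ, t ≠ -((k : ℂ) + 1)}

end

open scoped Topology ENNReal NNReal RealInnerProductSpace

/-! The proof combines an exact formula for the moments with an asymptotic analysis of Gamma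
products.

Exact formula. Up to sign, `n!` times the volume is the determinant of the square matrix whose first
row is the all-ones vector of `ℝ^(n+1)` and whose other `n` rows hold the coordinates of the points.
These `n` rows are independent standard Gaussian vectors in `ℝ^(n+1)`. By rotation invariance a
fixed row `a` may be turned onto an axis, so the absolute determinant has the law of `‖a‖` times a
Gaussian determinant of one size less (`map_absDet_cons`); here `‖a‖ = √(n+1)`. Conditioning on the
first row of a Gaussian determinant gives the same reduction (`gaussianDetLaw_succ`), so the
determinant is a product of independent norms of Gaussian vectors. The moment of order `t` is
therefore `(n+1)^(t/2) 2^(nt/2) ∏_{j=1}^n Γ((j+t)/2)/Γ(j/2)` (`hasMomentFunction_simplexVolume`).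
This is meromorphic with poles only at negative integers, which gives the continuation.

Asymptotics. Splitting `j` by parity leaves products `∏_{k ≤ N} Γ(k+u)/Γ(k)` at `u = t/2` and `u =
(t-1)/2`, the latter divided by its value at `t = 0` (`prod_Gamma_half_eq`). Multiplied by the
polynomial factors of the Weierstrass product of `G(1+u)`, such a product is exactly
`(Γ(N+1+u)/N!)^N` (`gammaProd_mul_prod`). The limit of this power requires the Gamma quotient up to
an error `o(1/N)` (`tendsto_gammaQuot_pow`); then `1/G(1+u)` appears (`tendsto_gammaProd`). The
elementary prefactors cancel against the centering and `(t²/4) log(n/2)`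
(`tendsto_prefactorExponent`).

Limits are taken along an arbitrary filter with a moving argument `u → u₀`; for the filter `atTop ×ˢ
𝓝 t` this is locally uniform convergence. -/

/-! ### Quotients of Gamma values with error `O(N⁻²)`. -/

/-- The normalized quotient `Γ(N + 1 + u) / (N! N^u)`. -/
noncomputable def gammaQuot (N : ℕ) (u : ℂ) : ℂ :=
  Complex.Gamma (N + 1 + u) / ((N.factorial : ℂ) * Complex.exp (u * (Real.log N : ℂ)))

/-- The logarithmic increment of `gammaQuot N u * exp (-(u ^ 2 + u) / (2 * N))`. -/
noncomputable def gammaQuotIncr (k : ℕ) (u : ℂ) : ℂ :=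
  Complex.log (1 + u / ((k : ℂ) + 1)) + u * Complex.log (1 + -(1 / ((k : ℂ) + 1)))
    - (u ^ 2 + u) / 2 * (1 / ((k : ℂ) + 1) - 1 / (k : ℂ))

lemma norm_log_one_add_sub_quadratic_le {z : ℂ} (hz : ‖z‖ ≤ 1 / 2) :
    ‖Complex.log (1 + z) - (z - z ^ 2 / 2)‖ ≤ ‖z‖ ^ 3 := by
  have h := Complex.norm_log_sub_logTaylor_le 2 (z := z) (by linarith)
  have h1 : Complex.logTaylor (2 + 1) z = z - z ^ 2 / 2 := by
    simp [Complex.logTaylor_succ, Complex.logTaylor_zero]; ring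
  rw [h1] at h
  refine h.trans ?_
  have h2 : (1 - ‖z‖)⁻¹ ≤ 2 := by
    rw [inv_le_comm₀ (by linarith) (by norm_num)]; linarith
  have h3 : 0 ≤ ‖z‖ ^ 3 := by positivity
  norm_num
  nlinarith

/-- The correction `(u² + u)/(2N)` is chosen so that the increments are of third order in `1/k`. The
bound is written as a difference so that it telescopes when summed. -/
lemma norm_gammaQuotIncr_le {R : ℝ} {k : ℕ} {u : ℂ} (hk : 1 ≤ k) (hu : ‖u‖ ≤ R)
    (hkR : 2 * R ≤ k) :
    ‖gammaQuotIncr k u‖ ≤ (R ^ 3 + R ^ 2 + 2 * R) * (1 / (k : ℝ) ^ 2 - 1 / ((k : ℝ) + 1) ^ 2) := by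
  have hR : 0 ≤ R := (norm_nonneg u).trans hu
  have hk1 : (1 : ℝ) ≤ k := by exact_mod_cast hk
  have hm0 : ((k : ℂ) + 1) ≠ 0 := by exact_mod_cast Nat.succ_ne_zero k
  have hk0 : (k : ℂ) ≠ 0 := by exact_mod_cast (by omega : k ≠ 0)
  have hmn : ‖((k : ℂ) + 1)‖ = (k : ℝ) + 1 := by
    rw [show ((k : ℂ) + 1) = ((k + 1 : ℕ) : ℂ) by push_cast; rfl, Complex.norm_natCast]; push_cast; rfl
  set m : ℝ := (k : ℝ) + 1 with hm
  have hmpos : 0 < m := by positivity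
  have e1 : ‖u / ((k : ℂ) + 1)‖ ≤ R / m := by
    rw [norm_div, hmn]; gcongr
  have e1' : R / m ≤ 1 / 2 := by rw [div_le_iff₀ hmpos]; linarith
  have e2 : ‖-(1 / ((k : ℂ) + 1))‖ = 1 / m := by rw [norm_neg, norm_div, hmn, norm_one]
  have e2' : 1 / m ≤ 1 / 2 := by rw [div_le_iff₀ hmpos]; linarith
  have h1 := (norm_log_one_add_sub_quadratic_le (e1.trans e1')).trans
    (pow_le_pow_left₀ (norm_nonneg _) e1 3)
  have h2 := norm_log_one_add_sub_quadratic_le (e2.le.trans e2')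
  rw [e2] at h2
  -- The first-order terms of the two logarithms cancel, and the second-order ones cancel against
  -- the correction up to `(u² + u)/(2k(k+1)²)`.
  have key : gammaQuotIncr k u =
      (Complex.log (1 + u / ((k : ℂ) + 1)) - (u / ((k : ℂ) + 1) - (u / ((k : ℂ) + 1)) ^ 2 / 2))
      + u * (Complex.log (1 + -(1 / ((k : ℂ) + 1)))
        - (-(1 / ((k : ℂ) + 1)) - (-(1 / ((k : ℂ) + 1))) ^ 2 / 2))
      + (u ^ 2 + u) / 2 * (1 / (((k : ℂ) + 1) ^ 2 * k)) := by
    rw [gammaQuotIncr]; field_simp; ring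
  have h3 : ‖(u ^ 2 + u) / 2 * (1 / (((k : ℂ) + 1) ^ 2 * k))‖
      ≤ (R ^ 2 + R) / 2 * (1 / (m ^ 2 * k)) := by
    rw [norm_mul, norm_div, norm_div, norm_mul, norm_pow, hmn, Complex.norm_natCast]
    simp only [Complex.norm_ofNat, norm_one]
    gcongr
    exact (norm_add_le _ _).trans (by rw [norm_pow]; gcongr)
  rw [key]
  refine (norm_add₃_le).trans ?_
  rw [norm_mul u]
  have h4 : ‖u‖ * ‖Complex.log (1 + -(1 / ((k : ℂ) + 1)))
        - (-(1 / ((k : ℂ) + 1)) - (-(1 / ((k : ℂ) + 1))) ^ 2 / 2)‖ ≤ R * (1 / m) ^ 3 := by gcongr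
  have h5 : 1 / (m ^ 2 * k) ≤ 2 * (1 / m) ^ 3 := by
    rw [one_div_pow, ← mul_div_assoc, mul_one, div_le_div_iff₀ (by positivity) (by positivity)]
    nlinarith [pow_pos hmpos 2]
  have h6 : (1 / m) ^ 3 ≤ 1 / (k : ℝ) ^ 2 - 1 / m ^ 2 := by
    rw [one_div_pow, div_sub_div _ _ (by positivity) (by positivity),
      div_le_div_iff₀ (by positivity) (by positivity)]
    have : (k : ℝ) = m - 1 := by rw [hm]; ring
    rw [this] at hk1 ⊢
    nlinarith [pow_pos hmpos 3, pow_pos hmpos 2, pow_pos hmpos 4]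
  calc _ ≤ (R / m) ^ 3 + R * (1 / m) ^ 3 + (R ^ 2 + R) / 2 * (2 * (1 / m) ^ 3) := by
        refine add_le_add (add_le_add h1 h4) (h3.trans ?_)
        gcongr
    _ = (R ^ 3 + R ^ 2 + 2 * R) * (1 / m) ^ 3 := by ring
    _ ≤ _ := by gcongr

lemma gammaQuot_succ {k : ℕ} {u : ℂ} (hk : 1 ≤ k) (hu : (k : ℂ) + 1 + u ≠ 0) :
    gammaQuot (k + 1) u * Complex.exp (-((u ^ 2 + u) / 2 * (1 / ((k : ℂ) + 1)))) =
    gammaQuot k u * Complex.exp (-((u ^ 2 + u) / 2 * (1 / (k : ℂ)))) *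
      Complex.exp (gammaQuotIncr k u) := by
  have hm0 : ((k : ℂ) + 1) ≠ 0 := by exact_mod_cast Nat.succ_ne_zero k
  have hk0 : (k : ℂ) ≠ 0 := by exact_mod_cast (by omega : k ≠ 0)
  have hkr : (k : ℝ) ≠ 0 := by exact_mod_cast (by omega : k ≠ 0)
  have hmr : (k : ℝ) + 1 ≠ 0 := by positivity
  have hfac : (k.factorial : ℂ) ≠ 0 := by exact_mod_cast k.factorial_ne_zero
  have hlog : Complex.log (1 + -(1 / ((k : ℂ) + 1))) = (Real.log k : ℂ) - (Real.log (k + 1) : ℂ) := by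
    rw [← Complex.ofReal_sub, ← Real.log_div hkr hmr, Complex.ofReal_log (by positivity)]
    congr 1; push_cast; field_simp; ring
  have h1 : 1 + u / ((k : ℂ) + 1) ≠ 0 := by
    intro h; apply hu; field_simp at h; linear_combination h
  have hexp : Complex.exp (gammaQuotIncr k u) = (1 + u / ((k : ℂ) + 1)) *
      Complex.exp (u * (Real.log k : ℂ)) / Complex.exp (u * (Real.log (k + 1) : ℂ)) *
      (Complex.exp (-((u ^ 2 + u) / 2 * (1 / ((k : ℂ) + 1)))) /
        Complex.exp (-((u ^ 2 + u) / 2 * (1 / (k : ℂ))))) := by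
    rw [mul_div_assoc, ← Complex.exp_sub, ← Complex.exp_sub]
    nth_rewrite 1 [← Complex.exp_log h1]
    rw [← Complex.exp_add, ← Complex.exp_add, gammaQuotIncr, hlog]
    congr 1; ring
  rw [hexp, gammaQuot, gammaQuot, Nat.factorial_succ]
  have hG : Complex.Gamma (((k + 1 : ℕ) : ℂ) + 1 + u) = (k + 1 + u) * Complex.Gamma (k + 1 + u) := by
    rw [← Complex.Gamma_add_one _ hu]; congr 1; push_cast; ring
  rw [hG]
  have := Complex.exp_ne_zero
  push_cast
  field_simp

/-- `Γ(N + 1 + u) / (N! N^u) → 1`. -/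
lemma tendsto_gammaQuot (u : ℂ) : Tendsto (fun N => gammaQuot N u) atTop (𝓝 1) := by
  -- In the right half-plane this is Euler's limit formula for `Γ`.
  have base : ∀ u : ℂ, 0 < u.re → Tendsto (fun N => gammaQuot N u) atTop (𝓝 1) := by
    intro u hu
    have hΓ := Complex.Gamma_ne_zero_of_re_pos hu
    have h := (Complex.GammaSeq_tendsto_Gamma u).inv₀ hΓ |>.const_mul (Complex.Gamma u)
    rw [mul_inv_cancel₀ hΓ] at h
    refine h.congr' ?_
    filter_upwards [eventually_ge_atTop 1] with N hN
    have hprod : ∀ M : ℕ, Complex.Gamma u * ∏ j ∈ Finset.range M, (u + j) =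
        Complex.Gamma (M + u) := by
      intro M
      induction M with
      | zero => simp
      | succ M ih =>
        rw [Finset.prod_range_succ, ← mul_assoc, ih, mul_comm]
        have : (M : ℂ) + u ≠ 0 := by
          intro h; have := congrArg Complex.re h
          simp at this
          have h0 : (0 : ℝ) ≤ M := by positivity
          linarith
        rw [add_comm u, ← Complex.Gamma_add_one _ this]; push_cast; congr 1; ring
    have hN0 : (N : ℂ) ≠ 0 := by exact_mod_cast (by omega : N ≠ 0)
    rw [Complex.GammaSeq, gammaQuot, inv_div, ← mul_div_assoc, hprod, Complex.cpow_def_of_ne_zero hN0,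
      ← Complex.natCast_log]
    push_cast
    rw [mul_comm u, mul_comm (N.factorial : ℂ)]
  -- The functional equation carries the limit one unit to the left.
  have step : ∀ u : ℂ, Tendsto (fun N => gammaQuot N (u + 1)) atTop (𝓝 1) →
      Tendsto (fun N => gammaQuot N u) atTop (𝓝 1) := by
    intro u h
    have hden : Tendsto (fun N : ℕ => (1 + u) * (1 / (N : ℂ)) + 1) atTop (𝓝 1) := by
      have := (tendsto_one_div_atTop_nhds_zero_nat (𝕜 := ℂ)).const_mul (1 + u) |>.add_const 1
      simpa using this
    have h2 := h.div hden one_ne_zero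
    rw [div_one] at h2
    refine h2.congr' ?_
    filter_upwards [eventually_ge_atTop 1, eventually_gt_atTop ⌈‖1 + u‖⌉₊] with N hN hNu
    have hN0 : (N : ℂ) ≠ 0 := by exact_mod_cast (by omega : N ≠ 0)
    have hne : (N : ℂ) + 1 + u ≠ 0 := by
      intro h
      have : (N : ℂ) = -(1 + u) := by linear_combination h
      have h3 := congrArg norm this
      rw [norm_neg, Complex.norm_natCast] at h3
      have := Nat.lt_of_ceil_lt hNu
      linarith
    have hne' : (1 + u) * (1 / (N : ℂ)) + 1 ≠ 0 := by
      intro h; apply hne; field_simp at h; linear_combination h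
    simp only [Pi.div_apply]
    rw [div_eq_iff hne', gammaQuot, gammaQuot, add_mul, Complex.exp_add, one_mul,
      ← add_assoc, Complex.Gamma_add_one _ hne]
    have hl : Complex.exp (Real.log N : ℂ) = N := by
      rw [← Complex.ofReal_exp, Real.exp_log (by exact_mod_cast hN)]; simp
    rw [hl]
    have hfac : (N.factorial : ℂ) ≠ 0 := by exact_mod_cast N.factorial_ne_zero
    have := Complex.exp_ne_zero
    field_simp
    ring
  have all : ∀ K : ℕ, ∀ u : ℂ, 0 < u.re + K → Tendsto (fun N => gammaQuot N u) atTop (𝓝 1) := by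
    intro K
    induction K with
    | zero => intro u hu; exact base u (by simpa using hu)
    | succ K ih =>
      intro u hu
      exact step u (ih (u + 1) (by simp; push_cast at hu; linarith))
  obtain ⟨K, hK⟩ := exists_nat_gt (-u.re)
  exact all K u (by linarith)

/-- The corrected quotient tends to `1`, and passing from index `N` to `N + M` multiplies it by `exp
w` with `w` bounded by a telescoping sum. Letting `M → ∞` gives an error `O(N⁻²)`, uniform on discs,
which survives the `N`-th power. -/
lemma norm_gammaQuot_mul_exp_sub_one_le {R : ℝ} {N : ℕ} {u : ℂ} (hN : 1 ≤ N) (hu : ‖u‖ ≤ R)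
    (hNR : 2 * R ≤ N) (hC : (R ^ 3 + R ^ 2 + 2 * R) * (1 / (N : ℝ) ^ 2) ≤ 1) :
    ‖gammaQuot N u * Complex.exp (-((u ^ 2 + u) / 2 * (1 / (N : ℂ)))) - 1‖ ≤
      2 * ((R ^ 3 + R ^ 2 + 2 * R) * (1 / (N : ℝ) ^ 2)) := by
  have hR : 0 ≤ R := (norm_nonneg u).trans hu
  set C := R ^ 3 + R ^ 2 + 2 * R
  have hC0 : 0 ≤ C := by positivity
  set s : ℕ → ℂ := fun N => gammaQuot N u * Complex.exp (-((u ^ 2 + u) / 2 * (1 / (N : ℂ)))) with hs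
  have hslim : Tendsto s atTop (𝓝 1) := by
    have h1 := (tendsto_one_div_atTop_nhds_zero_nat (𝕜 := ℂ)).const_mul ((u ^ 2 + u) / 2) |>.neg
    have := (tendsto_gammaQuot u).mul h1.cexp
    simpa [hs] using this
  have hM : ∀ M : ℕ, ∃ w : ℂ, s (N + M) = s N * Complex.exp w ∧
      ‖w‖ ≤ C * (1 / (N : ℝ) ^ 2 - 1 / ((N + M : ℕ) : ℝ) ^ 2) := by
    intro M
    induction M with
    | zero => exact ⟨0, by simp, by simp⟩
    | succ M ih =>
      obtain ⟨w, hw, hwn⟩ := ih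
      have hNM : (2 * R) ≤ ((N + M : ℕ) : ℝ) := by push_cast; linarith [(Nat.cast_nonneg M : (0:ℝ) ≤ M)]
      have hne : ((N + M : ℕ) : ℂ) + 1 + u ≠ 0 := by
        intro h
        have : ((N + M + 1 : ℕ) : ℂ) = -u := by push_cast at h ⊢; linear_combination h
        have h3 := congrArg norm this
        rw [norm_neg, Complex.norm_natCast] at h3
        push_cast at h3 hNM
        linarith
      refine ⟨w + gammaQuotIncr (N + M) u, ?_, ?_⟩
      · have := gammaQuot_succ (k := N + M) (u := u) (by omega) hne
        rw [Complex.exp_add, ← mul_assoc, ← hw]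
        simp only [hs]
        rw [← this]
        push_cast
        simp only [add_assoc]
      · refine (norm_add_le _ _).trans ?_
        have := norm_gammaQuotIncr_le (k := N + M) (by omega) hu hNM
        rw [show C * (1 / (N : ℝ) ^ 2 - 1 / ((N + (M + 1) : ℕ) : ℝ) ^ 2) =
          C * (1 / (N : ℝ) ^ 2 - 1 / ((N + M : ℕ) : ℝ) ^ 2) +
          C * (1 / ((N + M : ℕ) : ℝ) ^ 2 - 1 / (((N + M : ℕ) : ℝ) + 1) ^ 2) by push_cast; ring]
        exact add_le_add hwn this
  have hbd : ∀ M : ℕ, ‖s N - s (N + M)‖ ≤ ‖s (N + M)‖ * (2 * (C * (1 / (N : ℝ) ^ 2))) := by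
    intro M
    obtain ⟨w, hw, hwn⟩ := hM M
    have hwn' : ‖w‖ ≤ C * (1 / (N : ℝ) ^ 2) := hwn.trans (by
      apply mul_le_mul_of_nonneg_left _ hC0
      have : 0 ≤ 1 / ((N + M : ℕ) : ℝ) ^ 2 := by positivity
      linarith)
    have : s N - s (N + M) = s (N + M) * (Complex.exp (-w) - 1) := by
      rw [hw, Complex.exp_neg]
      have := Complex.exp_ne_zero w
      field_simp
    rw [this, norm_mul]
    gcongr
    have := Complex.norm_exp_sub_one_le (x := -w) (by rw [norm_neg]; linarith)
    rw [norm_neg] at this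
    linarith
  have hsl' : Tendsto (fun M => s (N + M)) atTop (𝓝 1) :=
    hslim.comp (tendsto_atTop_mono (fun M => by simp) tendsto_id)
  have := le_of_tendsto_of_tendsto' ((tendsto_const_nhds.sub hsl').norm) (hsl'.norm.mul_const _) hbd
  simpa [hs] using this

/-- `(Γ(N + 1 + u) / (N! N^u))^N → exp ((u² + u) / 2)`, locally uniformly in `u`. -/
lemma tendsto_gammaQuot_pow {α : Type*} {l : Filter α} {N : α → ℕ} {u : α → ℂ} {u₀ : ℂ}
    (hN : Tendsto N l atTop) (hu : Tendsto u l (𝓝 u₀)) :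
    Tendsto (fun a => gammaQuot (N a) (u a) ^ (N a)) l (𝓝 (Complex.exp ((u₀ ^ 2 + u₀) / 2))) := by
  set R := ‖u₀‖ + 1 with hR
  have hR0 : 0 ≤ R := by positivity
  set C := R ^ 3 + R ^ 2 + 2 * R with hC
  have hC0 : 0 ≤ C := by positivity
  have huR : ∀ᶠ a in l, ‖u a‖ ≤ R :=
    (hu.norm.eventually (gt_mem_nhds (by linarith : ‖u₀‖ < R))).mono fun a h => h.le
  have hNr : Tendsto (fun a => (N a : ℝ)) l atTop := tendsto_natCast_atTop_atTop.comp hN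
  have hinv : Tendsto (fun a => 1 / (N a : ℝ)) l (𝓝 0) := by
    simpa [Pi.inv_def] using hNr.inv_tendsto_atTop
  set s : α → ℂ := fun a => gammaQuot (N a) (u a) *
    Complex.exp (-((u a ^ 2 + u a) / 2 * (1 / (N a : ℂ)))) with hs
  have hinv2 : Tendsto (fun a => 2 * (C * (1 / (N a : ℝ) ^ 2))) l (𝓝 0) := by
    have := ((hinv.mul hinv).const_mul C).const_mul 2
    simp only [mul_zero] at this
    refine this.congr fun a => ?_
    ring
  have hsbd : ∀ᶠ a in l, ‖s a - 1‖ ≤ 2 * (C * (1 / (N a : ℝ) ^ 2)) := by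
    filter_upwards [huR, hN.eventually_ge_atTop 1, hNr.eventually_ge_atTop (2 * R),
      hinv2.eventually (gt_mem_nhds (by norm_num : (0 : ℝ) < 2))] with a h1 h2 h3 h4
    exact norm_gammaQuot_mul_exp_sub_one_le h2 h1 h3 (by linarith)
  -- Since `s = 1 + O(N⁻²)`, its `N`-th power tends to `1`, and the limit comes only from the
  -- correction factor.
  have hlog : Tendsto (fun a => (N a : ℂ) * Complex.log (s a)) l (𝓝 0) := by
    have hb : Tendsto (fun a => 4 * C * (1 / (N a : ℝ))) l (𝓝 0) := by
      simpa using hinv.const_mul (4 * C)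
    refine squeeze_zero_norm' ?_ hb
    filter_upwards [hsbd, hinv2.eventually (gt_mem_nhds (by norm_num : (0 : ℝ) < 1 / 2)),
      hN.eventually_ge_atTop 1] with a h1 h2 h3
    have h4 := Complex.norm_log_one_add_half_le_self (z := s a - 1) (by linarith)
    rw [add_sub_cancel] at h4
    rw [norm_mul, Complex.norm_natCast]
    have hNa : (0 : ℝ) < N a := by exact_mod_cast h3
    calc (N a : ℝ) * ‖Complex.log (s a)‖ ≤ N a * (3 / 2 * (2 * (C * (1 / (N a : ℝ) ^ 2)))) := by
          gcongr; linarith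
      _ = 3 * C * (1 / (N a : ℝ)) := by field_simp
      _ ≤ 4 * C * (1 / (N a : ℝ)) := by gcongr; norm_num
  have hlim : Tendsto (fun a => Complex.exp ((N a : ℂ) * Complex.log (s a)) *
      Complex.exp ((u a ^ 2 + u a) / 2)) l (𝓝 (Complex.exp ((u₀ ^ 2 + u₀) / 2))) := by
    have := hlog.cexp.mul (((hu.pow 2).add hu).div_const 2).cexp
    simpa using this
  refine hlim.congr' ?_
  filter_upwards [hsbd, hinv2.eventually (gt_mem_nhds (by norm_num : (0 : ℝ) < 1 / 2)),
      hN.eventually_ge_atTop 1] with a h1 h2 h3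
  have hs0 : s a ≠ 0 := by
    intro h; rw [h] at h1; norm_num at h1; norm_num at h2; linarith
  have hNa : (N a : ℂ) ≠ 0 := by exact_mod_cast (by omega : N a ≠ 0)
  rw [Complex.exp_nat_mul, Complex.exp_log hs0]
  simp only [hs]
  rw [mul_pow, ← Complex.exp_nat_mul, mul_assoc, ← Complex.exp_add]
  rw [show (N a : ℂ) * -((u a ^ 2 + u a) / 2 * (1 / (N a : ℂ))) + (u a ^ 2 + u a) / 2 = 0 by
    field_simp; ring]
  simp

/-! ### The Barnes function: entire, and nonzero off its zero set. -/

/-- Describing the domain as the nonvanishing set of an entire function makes its openness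
immediate. -/
lemma mem_complNegIntegers_iff {t : ℂ} :
    t ∈ complNegIntegers ↔ (Complex.Gamma (t + 1))⁻¹ ≠ 0 := by
  rw [ne_eq, inv_eq_zero]
  constructor
  · intro h
    refine Complex.Gamma_ne_zero fun m hm => h m ?_
    linear_combination hm
  · intro h k hk
    apply h
    rw [show t + 1 = -(k : ℂ) by rw [hk]; ring]
    exact Complex.Gamma_neg_nat_eq_zero k

lemma isOpen_complNegIntegers : IsOpen complNegIntegers := by
  have h : Continuous fun t : ℂ => (Complex.Gamma (t + 1))⁻¹ :=
    Complex.differentiable_one_div_Gamma.continuous.comp (continuous_add_const 1)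
  have : complNegIntegers = (fun t : ℂ => (Complex.Gamma (t + 1))⁻¹) ⁻¹' {0}ᶜ := by
    ext t; simp only [mem_complNegIntegers_iff]; rfl
  rw [this]
  exact isOpen_compl_singleton.preimage h

/-- The factors of the Weierstrass product of `G(1 + u)`. -/
noncomputable def barnesTerm (k : ℕ) (u : ℂ) : ℂ :=
  (1 + u / ((k : ℂ) + 1)) ^ (k + 1) * Complex.exp (u ^ 2 / (2 * ((k : ℂ) + 1)) - u)

lemma differentiable_barnesTerm (k : ℕ) : Differentiable ℂ (barnesTerm k) := by
  unfold barnesTerm; fun_prop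

/-- The exponential factor removes the first two Taylor terms of `(k+1) log(1 + u/(k+1))`, leaving a
remainder of order `(k+1)⁻²`, hence summable. -/
lemma norm_barnesTerm_sub_one_le {R : ℝ} {k : ℕ} {u : ℂ} (hu : ‖u‖ ≤ R)
    (hkR : 2 * R ≤ (k : ℝ) + 1) (hk : R ^ 3 * (1 / ((k : ℝ) + 1) ^ 2) ≤ 1) :
    ‖barnesTerm k u - 1‖ ≤ 2 * (R ^ 3 * (1 / ((k : ℝ) + 1) ^ 2)) := by
  have hm0 : ((k : ℂ) + 1) ≠ 0 := by exact_mod_cast Nat.succ_ne_zero k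
  have hmn : ‖((k : ℂ) + 1)‖ = (k : ℝ) + 1 := by
    rw [show ((k : ℂ) + 1) = ((k + 1 : ℕ) : ℂ) by push_cast; rfl, Complex.norm_natCast]; push_cast; rfl
  set m : ℝ := (k : ℝ) + 1 with hm
  have hmpos : 0 < m := by positivity
  have e1 : ‖u / ((k : ℂ) + 1)‖ ≤ R / m := by
    rw [norm_div, hmn]; gcongr
  have e1' : R / m ≤ 1 / 2 := by rw [div_le_iff₀ hmpos]; linarith
  have h1 := (norm_log_one_add_sub_quadratic_le (e1.trans e1')).trans
    (pow_le_pow_left₀ (norm_nonneg _) e1 3)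
  have hne : 1 + u / ((k : ℂ) + 1) ≠ 0 := by
    intro h
    have h2 : u / ((k : ℂ) + 1) = -1 := by linear_combination h
    rw [h2, norm_neg, norm_one] at e1
    linarith
  have key : barnesTerm k u = Complex.exp (((k : ℂ) + 1) * (Complex.log (1 + u / ((k : ℂ) + 1)) -
      (u / ((k : ℂ) + 1) - (u / ((k : ℂ) + 1)) ^ 2 / 2))) := by
    have h3 : (1 + u / ((k : ℂ) + 1)) ^ (k + 1) =
        Complex.exp (((k : ℂ) + 1) * Complex.log (1 + u / ((k : ℂ) + 1))) := by
      rw [show ((k : ℂ) + 1) = ((k + 1 : ℕ) : ℂ) by push_cast; rfl, Complex.exp_nat_mul,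
        Complex.exp_log (by push_cast; exact hne)]
    rw [barnesTerm, h3, ← Complex.exp_add]
    congr 1; field_simp; ring
  rw [key]
  have h4 : ‖((k : ℂ) + 1) * (Complex.log (1 + u / ((k : ℂ) + 1)) -
      (u / ((k : ℂ) + 1) - (u / ((k : ℂ) + 1)) ^ 2 / 2))‖ ≤ R ^ 3 * (1 / m ^ 2) := by
    rw [norm_mul, hmn]
    calc _ ≤ m * (R / m) ^ 3 := by gcongr
      _ = _ := by field_simp
  exact (Complex.norm_exp_sub_one_le (h4.trans hk)).trans (by linarith)

lemma summable_one_div_succ_sq (C : ℝ) :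
    Summable fun k : ℕ => 2 * (C * (1 / ((k : ℝ) + 1) ^ 2)) := by
  refine ((?_ : Summable fun k : ℕ => 1 / ((k : ℝ) + 1) ^ 2).mul_left C).mul_left 2
  have := (summable_nat_add_iff (f := fun k : ℕ => 1 / (k : ℝ) ^ 2) 1).mpr
    (Real.summable_one_div_nat_pow.mpr one_lt_two)
  simpa using this

lemma eventually_norm_barnesTerm_sub_one_le (R : ℝ) :
    ∀ᶠ k : ℕ in atTop, ∀ u ∈ Metric.ball (0 : ℂ) R,
      ‖barnesTerm k u - 1‖ ≤ 2 * (R ^ 3 * (1 / ((k : ℝ) + 1) ^ 2)) := by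
  have h1 : Tendsto (fun k : ℕ => 2 * (R ^ 3 * (1 / ((k : ℝ) + 1) ^ 2))) atTop (𝓝 0) :=
    (summable_one_div_succ_sq _).tendsto_atTop_zero
  filter_upwards [h1.eventually (gt_mem_nhds (by norm_num : (0 : ℝ) < 2)),
    tendsto_natCast_atTop_atTop.eventually_ge_atTop (2 * R)] with k hk hkR u hu
  exact norm_barnesTerm_sub_one_le (mem_ball_zero_iff.mp hu).le (by linarith) (by linarith)

lemma hasProdLocallyUniformlyOn_barnesTerm (R : ℝ) :
    HasProdLocallyUniformlyOn barnesTerm (fun u => ∏' k, barnesTerm k u) (Metric.ball 0 R) := by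
  have := Summable.hasProdLocallyUniformlyOn_nat_one_add (K := Metric.ball (0 : ℂ) R)
    (f := fun k u => barnesTerm k u - 1) Metric.isOpen_ball (summable_one_div_succ_sq (R ^ 3))
    (eventually_norm_barnesTerm_sub_one_le R)
    fun k => ((differentiable_barnesTerm k).continuous.sub continuous_const).continuousOn
  simpa using this

lemma differentiable_tprod_barnesTerm : Differentiable ℂ fun u => ∏' k, barnesTerm k u := by
  intro u
  have hu : u ∈ Metric.ball (0 : ℂ) (‖u‖ + 1) := by simp
  have h := (hasProdLocallyUniformlyOn_barnesTerm (‖u‖ + 1)).differentiableOn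
    (Eventually.of_forall fun s => (Differentiable.fun_finsetProd
      fun k _ => differentiable_barnesTerm k).differentiableOn) Metric.isOpen_ball
  exact h.differentiableAt (Metric.isOpen_ball.mem_nhds hu)

lemma tendsto_prod_barnesTerm {α : Type*} {l : Filter α} {N : α → ℕ} {u : α → ℂ} {u₀ : ℂ}
    (hN : Tendsto N l atTop) (hu : Tendsto u l (𝓝 u₀)) :
    Tendsto (fun a => ∏ k ∈ Finset.range (N a), barnesTerm k (u a)) l
      (𝓝 (∏' k, barnesTerm k u₀)) := by
  have hu₀ : u₀ ∈ Metric.ball (0 : ℂ) (‖u₀‖ + 1) := by simp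
  have hU := Metric.isOpen_ball.mem_nhds hu₀
  have h := hasProdLocallyUniformlyOn_barnesTerm (‖u₀‖ + 1)
  have h2 : TendstoLocallyUniformlyOn (fun a u => ∏ k ∈ Finset.range (N a), barnesTerm k u)
      (fun u => ∏' k, barnesTerm k u) l (Metric.ball 0 (‖u₀‖ + 1)) := by
    intro v hv x hx
    obtain ⟨t, ht, h3⟩ := h v hv x hx
    exact ⟨t, ht, (tendsto_finset_range.comp hN).eventually h3⟩
  exact h2.tendsto_comp differentiable_tprod_barnesTerm.continuous.continuousWithinAt hu₀
    (by rw [Metric.isOpen_ball.nhdsWithin_eq hu₀]; exact hu)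

/-- An absolutely convergent product vanishes only if a factor does, and the `k`-th factor vanishes
only at `-(k+1)`. -/
lemma tprod_barnesTerm_ne_zero {u : ℂ} (hu : u ∈ complNegIntegers) : ∏' k, barnesTerm k u ≠ 0 := by
  have hs : Summable fun k => ‖barnesTerm k u - 1‖ := by
    refine Summable.of_norm_bounded_eventually_nat (summable_one_div_succ_sq ((‖u‖ + 1) ^ 3)) ?_
    filter_upwards [eventually_norm_barnesTerm_sub_one_le (‖u‖ + 1)] with k hk
    simpa using hk u (by simp)
  have := tprod_one_add_ne_zero_of_summable (f := fun k => barnesTerm k u - 1) (fun k => ?_) hs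
  · simpa using this
  · rw [add_sub_cancel, barnesTerm]
    refine mul_ne_zero (pow_ne_zero _ fun h => hu k ?_) (Complex.exp_ne_zero _)
    have hm0 : ((k : ℂ) + 1) ≠ 0 := by exact_mod_cast Nat.succ_ne_zero k
    field_simp at h
    linear_combination h

lemma barnesG_one_add (u : ℂ) : barnesG (1 + u) =
    Complex.exp (u / 2 * (Real.log (2 * Real.pi) : ℂ)) *
      Complex.exp (-(u + (1 + (Real.eulerMascheroniConstant : ℂ)) * u ^ 2) / 2) *
        ∏' k, barnesTerm k u := by
  have : (2 * Real.pi : ℂ) ≠ 0 := by exact_mod_cast (by positivity : 2 * Real.pi ≠ 0)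
  rw [barnesG, add_sub_cancel_left, Complex.cpow_def_of_ne_zero this,
    Complex.ofReal_log (by positivity)]
  push_cast
  rw [mul_comm (Complex.log _)]
  rfl

lemma barnesG_one_add_ne_zero {u : ℂ} (hu : u ∈ complNegIntegers) : barnesG (1 + u) ≠ 0 := by
  rw [barnesG_one_add]
  exact mul_ne_zero (mul_ne_zero (Complex.exp_ne_zero _) (Complex.exp_ne_zero _))
    (tprod_barnesTerm_ne_zero hu)

lemma differentiable_barnesG : Differentiable ℂ barnesG := by
  have h : barnesG = (fun u => Complex.exp (u / 2 * (Real.log (2 * Real.pi) : ℂ)) *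
      Complex.exp (-(u + (1 + (Real.eulerMascheroniConstant : ℂ)) * u ^ 2) / 2) *
        ∏' k, barnesTerm k u) ∘ fun z => z - 1 := by
    ext z
    simp only [Function.comp]
    rw [← barnesG_one_add]; congr 1; ring
  rw [h]
  refine Differentiable.comp (.mul (.mul ?_ ?_) differentiable_tprod_barnesTerm) ?_ <;> fun_prop

/-! ### Gamma products and the Barnes function. -/

/-- The product `∏_{k = 1}^N Γ(k + u) / Γ(k)`. -/
noncomputable def gammaProd (N : ℕ) (u : ℂ) : ℂ :=
  ∏ k ∈ Finset.range N, Complex.Gamma (u + k + 1) / (k.factorial : ℂ)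

/-- A multiplicative summation by parts: `P_N = Γ(N+1+u)/N!` satisfies `P_{N+1} = P_N (1 +
u/(N+1))`, so `P_{N+1}^(N+1)` is `P_N^N` times one new factor of each product. -/
lemma gammaProd_mul_prod {u : ℂ} (hu : u ∈ complNegIntegers) (N : ℕ) :
    gammaProd N u * ∏ k ∈ Finset.range N, (1 + u / ((k : ℂ) + 1)) ^ (k + 1) =
      (Complex.Gamma (N + 1 + u) / (N.factorial : ℂ)) ^ N := by
  induction N with
  | zero => simp [gammaProd]
  | succ N ih =>
    rw [gammaProd, Finset.prod_range_succ, Finset.prod_range_succ]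
    have hne : (N : ℂ) + 1 + u ≠ 0 := fun h => hu N (by linear_combination h)
    have hG : Complex.Gamma (((N + 1 : ℕ) : ℂ) + 1 + u) =
        (N + 1 + u) * Complex.Gamma (N + 1 + u) := by
      rw [← Complex.Gamma_add_one _ hne]; congr 1; push_cast; ring
    have hm0 : ((N : ℂ) + 1) ≠ 0 := by exact_mod_cast Nat.succ_ne_zero N
    have hfac : (N.factorial : ℂ) ≠ 0 := by exact_mod_cast N.factorial_ne_zero
    rw [mul_mul_mul_comm, ← gammaProd, ih, hG, Nat.factorial_succ]
    rw [show u + (N : ℂ) + 1 = N + 1 + u by ring,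
      show 1 + u / ((N : ℂ) + 1) = (N + 1 + u) / (N + 1) by field_simp,
      ← mul_assoc, ← pow_succ, ← mul_pow]
    congr 1
    push_cast
    field_simp

/-- The logarithm of the growth rate of `gammaProd N u`. -/
noncomputable def gammaProdExponent (N : ℕ) (u : ℂ) : ℂ :=
  u / 2 * (Real.log (2 * Real.pi) : ℂ) + (N * u + u ^ 2 / 2) * (Real.log N : ℂ) - N * u

/-- The convergence factors `exp(u²/(2(k+1)))` multiply to a harmonic number. Paired with `log N`,
it supplies Euler's constant in the limit. -/
lemma gammaProd_mul_exp_mul_prod {u : ℂ} (hu : u ∈ complNegIntegers) (N : ℕ) :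
    gammaProd N u * Complex.exp (-gammaProdExponent N u) *
      ∏ k ∈ Finset.range N, barnesTerm k u =
    gammaQuot N u ^ N * Complex.exp (u ^ 2 / 2 * ((harmonic N - Real.log N : ℝ) : ℂ)) *
      Complex.exp (-(u / 2 * (Real.log (2 * Real.pi) : ℂ))) := by
  have hB : ∏ k ∈ Finset.range N, barnesTerm k u =
      (∏ k ∈ Finset.range N, (1 + u / ((k : ℂ) + 1)) ^ (k + 1)) *
        Complex.exp (u ^ 2 / 2 * ((harmonic N : ℝ) : ℂ) - N * u) := by
    simp only [barnesTerm]
    rw [Finset.prod_mul_distrib, ← Complex.exp_sum, Finset.sum_sub_distrib]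
    congr 3
    · rw [harmonic]
      push_cast
      rw [Finset.mul_sum]
      refine Finset.sum_congr rfl fun k _ => ?_
      field_simp
    · simp
  have hq : gammaQuot N u ^ N = (Complex.Gamma (N + 1 + u) / (N.factorial : ℂ)) ^ N *
      Complex.exp (-(N * u * (Real.log N : ℂ))) := by
    rw [gammaQuot, div_mul_eq_div_div, div_pow _ (Complex.exp _), ← Complex.exp_nat_mul,
      Complex.exp_neg, div_eq_mul_inv, mul_assoc (N : ℂ)]
  rw [hB, hq, ← gammaProd_mul_prod hu]
  have : Complex.exp (-gammaProdExponent N u) *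
      Complex.exp (u ^ 2 / 2 * ((harmonic N : ℝ) : ℂ) - N * u) =
      Complex.exp (-(N * u * (Real.log N : ℂ))) *
      Complex.exp (u ^ 2 / 2 * ((harmonic N - Real.log N : ℝ) : ℂ)) *
      Complex.exp (-(u / 2 * (Real.log (2 * Real.pi) : ℂ))) := by
    rw [← Complex.exp_add, ← Complex.exp_add, ← Complex.exp_add, gammaProdExponent]
    congr 1; push_cast; ring
  linear_combination (gammaProd N u * ∏ k ∈ Finset.range N, (1 + u / ((k : ℂ) + 1)) ^ (k + 1)) * this

/-- `∏_{k ≤ N} Γ(k + u) / Γ(k)` is asymptotic to `exp (gammaProdExponent N u) / G(1 + u)`, locally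
uniformly in `u`. -/
lemma tendsto_gammaProd {α : Type*} {l : Filter α} {N : α → ℕ} {u : α → ℂ} {u₀ : ℂ}
    (hN : Tendsto N l atTop) (hu : Tendsto u l (𝓝 u₀)) (hu₀ : u₀ ∈ complNegIntegers) :
    Tendsto (fun a => gammaProd (N a) (u a) * Complex.exp (-gammaProdExponent (N a) (u a))) l
      (𝓝 (barnesG (1 + u₀))⁻¹) := by
  have h1 := tendsto_gammaQuot_pow hN hu
  have h2 := tendsto_prod_barnesTerm hN hu
  have hne := tprod_barnesTerm_ne_zero hu₀
  have h3 : Tendsto (fun a => ((harmonic (N a) - Real.log (N a) : ℝ) : ℂ)) l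
      (𝓝 (Real.eulerMascheroniConstant : ℂ)) :=
    (Complex.continuous_ofReal.tendsto _).comp (Real.tendsto_harmonic_sub_log.comp hN)
  have h4 := ((h1.mul (((hu.pow 2).div_const 2).mul h3).cexp).mul
    ((hu.div_const 2).mul_const (Real.log (2 * Real.pi) : ℂ)).neg.cexp).div h2 hne
  have hlim : Complex.exp ((u₀ ^ 2 + u₀) / 2) *
      Complex.exp (u₀ ^ 2 / 2 * (Real.eulerMascheroniConstant : ℂ)) *
      Complex.exp (-(u₀ / 2 * (Real.log (2 * Real.pi) : ℂ))) / ∏' k, barnesTerm k u₀ =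
      (barnesG (1 + u₀))⁻¹ := by
    rw [barnesG_one_add, mul_inv, div_eq_mul_inv, ← Complex.exp_add, ← Complex.exp_add,
      ← Complex.exp_add, ← Complex.exp_neg]
    congr 2; ring
  rw [hlim] at h4
  refine h4.congr' ?_
  filter_upwards [hu.eventually (isOpen_complNegIntegers.mem_nhds hu₀), h2.eventually_ne hne]
    with a ha hne'
  simp only [Pi.div_apply]
  rw [div_eq_iff hne', gammaProd_mul_exp_mul_prod ha]

/-! ### Asymptotics and continuation of the explicit moment function. -/

/-- The moment generating function of `log (n! V)` for the Gaussian simplex in `ℝⁿ`. -/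
noncomputable def simplexMoment (n : ℕ) (t : ℂ) : ℂ :=
  Complex.exp (t / 2 * (Real.log (n + 1) : ℂ)) * Complex.exp (n * (t / 2) * (Real.log 2 : ℂ)) *
    ∏ j ∈ Finset.range n, Complex.Gamma ((j + 1 + t) / 2) / Complex.Gamma ((j + 1) / 2)

/-- The centred moment generating function and its meromorphic continuation. -/
noncomputable def centeredMoment (n : ℕ) (t : ℂ) : ℂ :=
  Complex.exp (-(t * (fullDimCentering n : ℂ))) * simplexMoment n t

lemma half_mem_complNegIntegers {t : ℂ} (ht : t ∈ complNegIntegers) :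
    t / 2 ∈ complNegIntegers := fun k hk => ht (2 * k + 1) (by push_cast; linear_combination 2 * hk)

lemma half_sub_one_mem_complNegIntegers {t : ℂ} (ht : t ∈ complNegIntegers) :
    (t - 1) / 2 ∈ complNegIntegers := fun k hk => ht (2 * k) (by push_cast; linear_combination 2 * hk)

lemma neg_half_mem_complNegIntegers : (-1 / 2 : ℂ) ∈ complNegIntegers := by
  have : (0 : ℂ) ∈ complNegIntegers := fun k hk => by
    have h : ((k + 1 : ℕ) : ℂ) = 0 := by push_cast; linear_combination hk
    exact absurd h (by exact_mod_cast Nat.succ_ne_zero k)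
  simpa using half_sub_one_mem_complNegIntegers this

/-- Odd `j = 2k+1` gives `Γ(t/2 + k + 1)/k!`. Even `j = 2k` gives a ratio of values at `(t-1)/2` and
`-1/2`, where the common `k!` cancels. The lengths are `⌊n/2⌋` and `⌈n/2⌉`. -/
lemma prod_Gamma_half_eq (n : ℕ) (t : ℂ) :
    ∏ j ∈ Finset.range n, Complex.Gamma ((j + 1 + t) / 2) / Complex.Gamma ((j + 1) / 2) =
      gammaProd (n / 2) (t / 2) *
        (gammaProd ((n + 1) / 2) ((t - 1) / 2) / gammaProd ((n + 1) / 2) (-1 / 2)) := by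
  induction n with
  | zero => simp [gammaProd]
  | succ n ih =>
    rw [Finset.prod_range_succ, ih]
    obtain ⟨k, rfl | rfl⟩ := n.even_or_odd'
    · rw [show (2 * k + 1) / 2 = k by omega, show 2 * k / 2 = k by omega,
        show (2 * k + 1 + 1) / 2 = k + 1 by omega]
      simp only [gammaProd, Finset.prod_range_succ]
      have h1 : (((2 * k : ℕ) : ℂ) + 1 + t) / 2 = (t - 1) / 2 + k + 1 := by push_cast; ring
      have h2 : (((2 * k : ℕ) : ℂ) + 1) / 2 = -1 / 2 + k + 1 := by push_cast; ring
      rw [h1, h2]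
      have hfac : (k.factorial : ℂ) ≠ 0 := by exact_mod_cast k.factorial_ne_zero
      rw [mul_div_mul_comm, div_div_div_cancel_right₀ hfac, mul_assoc]
    · rw [show (2 * k + 1) / 2 = k by omega, show (2 * k + 1 + 1) / 2 = k + 1 by omega,
        show (2 * k + 1 + 1 + 1) / 2 = k + 1 by omega]
      have h1 : (((2 * k + 1 : ℕ) : ℂ) + 1 + t) / 2 = t / 2 + k + 1 := by push_cast; ring
      have h2 : (((2 * k + 1 : ℕ) : ℂ) + 1) / 2 = k + 1 := by push_cast; ring
      rw [h1, h2, Complex.Gamma_nat_eq_factorial]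
      simp only [gammaProd, Finset.prod_range_succ _ k]
      ring

lemma tendsto_two_mul_half_div :
    Tendsto (fun n : ℕ => 2 * ((n / 2 : ℕ) : ℝ) / n) atTop (𝓝 1) ∧
    Tendsto (fun n : ℕ => 2 * (((n + 1) / 2 : ℕ) : ℝ) / n) atTop (𝓝 1) := by
  have h0 := tendsto_one_div_atTop_nhds_zero_nat (𝕜 := ℝ)
  have hl : Tendsto (fun n : ℕ => 1 - 1 / (n : ℝ)) atTop (𝓝 1) := by
    simpa using (tendsto_const_nhds (x := (1 : ℝ))).sub h0
  have hr : Tendsto (fun n : ℕ => 1 + 1 / (n : ℝ)) atTop (𝓝 1) := by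
    simpa using (tendsto_const_nhds (x := (1 : ℝ))).add h0
  constructor
  all_goals
    refine tendsto_of_tendsto_of_tendsto_of_le_of_le' hl hr ?_ ?_
    all_goals
      filter_upwards [eventually_ge_atTop 1] with n hn
      have hn0 : (0 : ℝ) < n := by exact_mod_cast hn
  · rw [le_div_iff₀ hn0, sub_mul, one_div_mul_cancel hn0.ne']
    have : n ≤ 2 * (n / 2) + 1 := by omega
    have : (n : ℝ) ≤ 2 * ((n / 2 : ℕ) : ℝ) + 1 := by exact_mod_cast this
    linarith
  · rw [div_le_iff₀ hn0, add_mul, one_div_mul_cancel hn0.ne']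
    have : 2 * (n / 2) ≤ n := by omega
    have : 2 * ((n / 2 : ℕ) : ℝ) ≤ n := by exact_mod_cast this
    linarith
  · rw [le_div_iff₀ hn0, sub_mul, one_div_mul_cancel hn0.ne']
    have : n ≤ 2 * ((n + 1) / 2) := by omega
    have : (n : ℝ) ≤ 2 * (((n + 1) / 2 : ℕ) : ℝ) := by exact_mod_cast this
    linarith
  · rw [div_le_iff₀ hn0, add_mul, one_div_mul_cancel hn0.ne']
    have : 2 * ((n + 1) / 2) ≤ n + 1 := by omega
    have : 2 * (((n + 1) / 2 : ℕ) : ℝ) ≤ n + 1 := by exact_mod_cast this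
    linarith

/-- Each logarithm may be of order `1/n` with a weight of order `n`; only the sum is small, because
the first-order terms cancel when the two halves add up to `n`. -/
lemma tendsto_half_mul_log :
    Tendsto (fun n : ℕ => (((n + 1) / 2 : ℕ) : ℝ) * Real.log (2 * (((n + 1) / 2 : ℕ) : ℝ) / n) +
      ((n / 2 : ℕ) : ℝ) * Real.log (2 * ((n / 2 : ℕ) : ℝ) / n)) atTop (𝓝 0) := by
  refine tendsto_of_tendsto_of_tendsto_of_le_of_le' tendsto_const_nhds
    (tendsto_one_div_atTop_nhds_zero_nat (𝕜 := ℝ)) ?_ ?_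
  all_goals
    filter_upwards [eventually_ge_atTop 2] with n hn
    have hn0 : (0 : ℝ) < n := by exact_mod_cast (by omega : 0 < n)
    have hb0 : (0 : ℝ) < ((n / 2 : ℕ) : ℝ) := by exact_mod_cast (by omega : 0 < n / 2)
    have ha0 : (0 : ℝ) < (((n + 1) / 2 : ℕ) : ℝ) := by exact_mod_cast (by omega : 0 < (n + 1) / 2)
    have hab : (((n + 1) / 2 : ℕ) : ℝ) + ((n / 2 : ℕ) : ℝ) = n := by
      exact_mod_cast (by omega : (n + 1) / 2 + n / 2 = n)
    have h1 : (((n + 1) / 2 : ℕ) : ℝ) ≤ ((n / 2 : ℕ) : ℝ) + 1 := by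
      exact_mod_cast (by omega : (n + 1) / 2 ≤ n / 2 + 1)
    have h2 : ((n / 2 : ℕ) : ℝ) ≤ (((n + 1) / 2 : ℕ) : ℝ) := by
      exact_mod_cast (by omega : n / 2 ≤ (n + 1) / 2)
    generalize (((n + 1) / 2 : ℕ) : ℝ) = a at *
    generalize ((n / 2 : ℕ) : ℝ) = b at *
    generalize (n : ℝ) = x at *
    subst hab
  -- The lower bounds for `y = a` and `y = b` add up to exactly `0`.
  · have key : ∀ y : ℝ, 0 < y → y - (a + b) / 2 ≤ y * Real.log (2 * y / (a + b)) := by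
      intro y hy
      have := Real.one_sub_inv_le_log_of_pos (x := 2 * y / (a + b)) (by positivity)
      calc y - (a + b) / 2 = y * (1 - (2 * y / (a + b))⁻¹) := by field_simp
        _ ≤ _ := by gcongr
    linarith [key a ha0, key b hb0]
  · have key : ∀ y : ℝ, 0 < y → y * Real.log (2 * y / (a + b)) ≤ y * (2 * y / (a + b) - 1) := by
      intro y hy
      have := Real.log_le_sub_one_of_pos (x := 2 * y / (a + b)) (by positivity)
      gcongr
    -- The two halves differ by at most one, so `(a - b)² ≤ 1`.
    have h3 : a * (2 * a / (a + b) - 1) + b * (2 * b / (a + b) - 1) ≤ 1 / (a + b) := by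
      rw [show a * (2 * a / (a + b) - 1) + b * (2 * b / (a + b) - 1) = (a - b) ^ 2 / (a + b) by
        field_simp; ring]
      gcongr
      nlinarith
    linarith [key a ha0, key b hb0]

/-- The logarithm of the deterministic prefactor in the asymptotics of `centeredMoment`. -/
noncomputable def prefactorExponent (n : ℕ) (t : ℂ) : ℂ :=
  -(t * (fullDimCentering n : ℂ)) + t / 2 * (Real.log (n + 1) : ℂ) +
    n * (t / 2) * (Real.log 2 : ℂ) + gammaProdExponent (n / 2) (t / 2) +
    gammaProdExponent ((n + 1) / 2) ((t - 1) / 2) - gammaProdExponent ((n + 1) / 2) (-1 / 2)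
    - (1 / 4) * t ^ 2 * (Real.log ((n : ℝ) / 2) : ℂ)

/-- The centering and the Gaussian parameter absorb everything except logarithms of ratios tending
to `1`. At `n = 1` the half `n / 2` is `0`, and expanding `log (2 * 0 / n)` would fail. -/
lemma prefactorExponent_eq {n : ℕ} (hn : 2 ≤ n) (t : ℂ) : prefactorExponent n t =
    t ^ 2 * (((Real.log (2 * (((n + 1) / 2 : ℕ) : ℝ) / n) +
      Real.log (2 * ((n / 2 : ℕ) : ℝ) / n)) / 8 : ℝ) : ℂ) +
    t * ((((((n + 1) / 2 : ℕ) : ℝ) * Real.log (2 * (((n + 1) / 2 : ℕ) : ℝ) / n) +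
      ((n / 2 : ℕ) : ℝ) * Real.log (2 * ((n / 2 : ℕ) : ℝ) / n)) / 2 +
      Real.log (1 + 1 / n) / 2 - Real.log (2 * (((n + 1) / 2 : ℕ) : ℝ) / n) / 4 : ℝ) : ℂ) := by
  have hn0 : (0 : ℝ) < n := by exact_mod_cast (by omega : 0 < n)
  have hb0 : (0 : ℝ) < ((n / 2 : ℕ) : ℝ) := by exact_mod_cast (by omega : 0 < n / 2)
  have ha0 : (0 : ℝ) < (((n + 1) / 2 : ℕ) : ℝ) := by exact_mod_cast (by omega : 0 < (n + 1) / 2)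
  have hab : (((n + 1) / 2 : ℕ) : ℂ) = n - ((n / 2 : ℕ) : ℂ) := by
    rw [eq_sub_iff_add_eq]
    exact_mod_cast (by omega : (n + 1) / 2 + n / 2 = n)
  have e1 : Real.log (1 + 1 / (n : ℝ)) = Real.log (n + 1) - Real.log n := by
    rw [← Real.log_div (by positivity) hn0.ne']; congr 1; field_simp
  have e2 : ∀ x : ℝ, 0 < x → Real.log (2 * x / n) = Real.log 2 + Real.log x - Real.log n := by
    intro x hx
    rw [Real.log_div (by positivity) hn0.ne', Real.log_mul two_ne_zero hx.ne']
  have e3 : Real.log ((2 : ℝ) ^ ((3 : ℝ) / 2) * Real.pi) = 3 / 2 * Real.log 2 + Real.log Real.pi := by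
    rw [Real.log_mul (by positivity) Real.pi_ne_zero, Real.log_rpow two_pos]
  rw [prefactorExponent, gammaProdExponent, gammaProdExponent, gammaProdExponent, fullDimCentering,
    e1, e2 _ ha0, e2 _ hb0, e3, Real.log_mul two_ne_zero Real.pi_ne_zero,
    Real.log_div hn0.ne' two_ne_zero]
  push_cast
  rw [hab]
  ring

lemma tendsto_prefactorExponent {α : Type*} {l : Filter α} {N : α → ℕ} {u : α → ℂ} {u₀ : ℂ}
    (hN : Tendsto N l atTop) (hu : Tendsto u l (𝓝 u₀)) :
    Tendsto (fun a => prefactorExponent (N a) (u a)) l (𝓝 0) := by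
  obtain ⟨hb, ha⟩ := tendsto_two_mul_half_div
  have hb' := hb.log one_ne_zero
  have ha' := ha.log one_ne_zero
  rw [Real.log_one] at hb' ha'
  have hr : Tendsto (fun n : ℕ => Real.log (1 + 1 / (n : ℝ))) atTop (𝓝 0) := by
    have := ((tendsto_one_div_atTop_nhds_zero_nat (𝕜 := ℝ)).const_add 1).log (by norm_num)
    simpa using this
  have h1 := (Complex.continuous_ofReal.tendsto _).comp (((ha'.add hb').div_const 8).comp hN)
  have h2 := (Complex.continuous_ofReal.tendsto _).comp
    ((((tendsto_half_mul_log.div_const 2).add (hr.div_const 2)).sub (ha'.div_const 4)).comp hN)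
  have h3 := ((hu.pow 2).mul h1).add (hu.mul h2)
  simp only [add_zero, zero_div, sub_zero, Complex.ofReal_zero, mul_zero] at h3
  refine h3.congr' ?_
  filter_upwards [hN.eventually_ge_atTop 2] with a ha
  rw [prefactorExponent_eq ha]
  rfl

lemma tendsto_centeredMoment {α : Type*} {l : Filter α} {N : α → ℕ} {u : α → ℂ} {u₀ : ℂ}
    (hN : Tendsto N l atTop) (hu : Tendsto u l (𝓝 u₀)) (hu₀ : u₀ ∈ complNegIntegers) :
    Tendsto (fun a => centeredMoment (N a) (u a) /
      Complex.exp ((1 / 4) * u a ^ 2 * (Real.log ((N a : ℝ) / 2) : ℂ))) l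
      (𝓝 (fullDimLimit u₀)) := by
  have hNb : Tendsto (fun a => N a / 2) l atTop :=
    (Nat.tendsto_div_const_atTop two_ne_zero).comp hN
  have hNa : Tendsto (fun a => (N a + 1) / 2) l atTop :=
    (Nat.tendsto_div_const_atTop two_ne_zero).comp
      (tendsto_atTop_mono (fun a => Nat.le_succ _) hN)
  have h1 := tendsto_gammaProd hNb (hu.div_const 2) (half_mem_complNegIntegers hu₀)
  have h2 := tendsto_gammaProd hNa ((hu.sub_const 1).div_const 2)
    (half_sub_one_mem_complNegIntegers hu₀)
  have h3 := tendsto_gammaProd hNa (tendsto_const_nhds (x := (-1 / 2 : ℂ)))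
    neg_half_mem_complNegIntegers
  have h4 := (h1.mul (h2.div h3 (inv_ne_zero (barnesG_one_add_ne_zero
    neg_half_mem_complNegIntegers)))).mul (tendsto_prefactorExponent hN hu).cexp
  have hlim : (barnesG (1 + u₀ / 2))⁻¹ * ((barnesG (1 + (u₀ - 1) / 2))⁻¹ /
      (barnesG (1 + -1 / 2))⁻¹) * Complex.exp 0 = fullDimLimit u₀ := by
    rw [show 1 + (u₀ - 1) / 2 = 1 / 2 + u₀ / 2 by ring, show (1 + -1 / 2 : ℂ) = 1 / 2 by norm_num,
      fullDimLimit, Complex.exp_zero, mul_one, div_inv_eq_mul, div_eq_mul_inv (barnesG (1 / 2)),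
      mul_inv]
    ring
  rw [hlim] at h4
  refine h4.congr fun a => ?_
  have hne := Complex.exp_ne_zero
  simp only [Pi.div_apply]
  rw [centeredMoment, simplexMoment, prod_Gamma_half_eq, prefactorExponent]
  simp only [Complex.exp_neg, Complex.exp_add, Complex.exp_sub]
  have e1 := hne (gammaProdExponent (N a / 2) (u a / 2))
  have e2 := hne (gammaProdExponent ((N a + 1) / 2) ((u a - 1) / 2))
  have e3 := hne (gammaProdExponent ((N a + 1) / 2) (-1 / 2))
  field_simp

lemma fullDimLimit_denominator_ne_zero {t : ℂ} (ht : t ∈ complNegIntegers) :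
    barnesG (1 / 2 + t / 2) * barnesG (1 + t / 2) ≠ 0 := by
  refine mul_ne_zero ?_ (barnesG_one_add_ne_zero (half_mem_complNegIntegers ht))
  rw [show 1 / 2 + t / 2 = 1 + (t - 1) / 2 by ring]
  exact barnesG_one_add_ne_zero (half_sub_one_mem_complNegIntegers ht)

lemma analyticOnNhd_fullDimLimit : AnalyticOnNhd ℂ fullDimLimit complNegIntegers := by
  refine DifferentiableOn.analyticOnNhd (fun t ht => ?_) isOpen_complNegIntegers
  refine DifferentiableAt.differentiableWithinAt ?_
  have h := differentiable_barnesG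
  refine DifferentiableAt.div (by fun_prop) ?_ (fullDimLimit_denominator_ne_zero ht)
  fun_prop

/-- The joint limit along `atTop ×ˢ 𝓝 t`, with continuity of the limit function, is locally uniform
convergence; on an open set this is uniform convergence on compact subsets. -/
lemma tendstoUniformlyOn_centeredMoment {K : Set ℂ} (hK : IsCompact K) (hKs : K ⊆ complNegIntegers) :
    TendstoUniformlyOn (fun (n : ℕ) t => centeredMoment n t /
      Complex.exp ((1 / 4) * t ^ 2 * (Real.log ((n : ℝ) / 2) : ℂ))) fullDimLimit atTop K := by
  have h : TendstoLocallyUniformlyOn (fun (n : ℕ) t => centeredMoment n t /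
      Complex.exp ((1 / 4) * t ^ 2 * (Real.log ((n : ℝ) / 2) : ℂ))) fullDimLimit atTop
      complNegIntegers := by
    rw [tendstoLocallyUniformlyOn_iff_filter]
    intro t ht
    rw [isOpen_complNegIntegers.nhdsWithin_eq ht, tendstoUniformlyOnFilter_iff_tendsto]
    have h1 : Tendsto (fun q : ℕ × ℂ => fullDimLimit q.2) (atTop ×ˢ 𝓝 t) (𝓝 (fullDimLimit t)) :=
      (analyticOnNhd_fullDimLimit t ht).continuousAt.tendsto.comp tendsto_snd
    exact (h1.prodMk_nhds (tendsto_centeredMoment tendsto_fst tendsto_snd ht)).mono_right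
      (nhds_le_uniformity _)
  exact (tendstoLocallyUniformlyOn_iff_forall_isCompact isOpen_complNegIntegers).mp h K hKs hK

lemma analyticOnNhd_centeredMoment (n : ℕ) : AnalyticOnNhd ℂ (centeredMoment n) complNegIntegers := by
  refine DifferentiableOn.analyticOnNhd (fun t ht => ?_) isOpen_complNegIntegers
  refine DifferentiableAt.differentiableWithinAt ?_
  unfold centeredMoment simplexMoment
  refine DifferentiableAt.mul (by fun_prop) (DifferentiableAt.mul (by fun_prop) ?_)
  refine DifferentiableAt.fun_finsetProd fun j _ => DifferentiableAt.div_const ?_ _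
  -- A pole at `(j + 1 + t)/2 = -m` means `t = -(2m + j + 1)`.
  refine DifferentiableAt.comp t (Complex.differentiableAt_Gamma _ fun m hm => ht (2 * m + j) ?_)
    (by fun_prop)
  push_cast
  linear_combination 2 * hm

lemma meromorphicOn_centeredMoment (n : ℕ) : MeromorphicOn (centeredMoment n) univ := by
  intro t _
  unfold centeredMoment simplexMoment
  have h1 : ∀ f : ℂ → ℂ, Differentiable ℂ f → MeromorphicAt f t := fun f hf =>
    (hf.analyticAt t).meromorphicAt
  refine (h1 _ (by fun_prop)).mul (((h1 _ (by fun_prop)).mul (h1 _ (by fun_prop))).mul ?_)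
  refine MeromorphicAt.fun_prod fun j _ => MeromorphicAt.div ?_ (MeromorphicAt.const _ _)
  -- Meromorphy of `Γ` is obtained by inverting the entire function `1/Γ`.
  have h2 : Differentiable ℂ fun z => (Complex.Gamma (((j : ℂ) + 1 + z) / 2))⁻¹ :=
    Complex.differentiable_one_div_Gamma.comp (by fun_prop)
  simpa [Pi.inv_def] using (h1 _ h2).inv

/-! ### Complex moments of products and of Gaussian norms. -/

/-- `M t` is the moment of complex order `t` of the law `ν` on `ℝ`, for `Re t > -1`, and `ν` has no
atom at `0`. -/
structure HasMomentFunction (ν : Measure ℝ) (M : ℂ → ℂ) : Prop where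
  ae_ne_zero : ∀ᵐ x ∂ν, x ≠ 0
  integrable : ∀ t : ℂ, -1 < t.re → Integrable (fun x : ℝ => Complex.exp (t * (Real.log x : ℂ))) ν
  integral_eq : ∀ t : ℂ, -1 < t.re → ∫ x : ℝ, Complex.exp (t * (Real.log x : ℂ)) ∂ν = M t

lemma measurableSet_ne_zero : MeasurableSet {x : ℝ | x ≠ 0} :=
  (measurableSet_singleton (0 : ℝ)).compl

lemma measurable_exp_mul_log (t : ℂ) : Measurable fun x : ℝ => Complex.exp (t * (Real.log x : ℂ)) := by
  fun_prop

lemma HasMomentFunction.mul {ν ρ : Measure ℝ} [IsProbabilityMeasure ν] [IsProbabilityMeasure ρ]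
    {M L : ℂ → ℂ} (hν : HasMomentFunction ν M) (hρ : HasMomentFunction ρ L) :
    HasMomentFunction ((ν.prod ρ).map fun p => p.1 * p.2) fun t => M t * L t := by
  have hm : Measurable fun p : ℝ × ℝ => p.1 * p.2 := by fun_prop
  have h1 : ∀ᵐ p ∂(ν.prod ρ), p.1 ≠ 0 := Measure.quasiMeasurePreserving_fst.ae hν.ae_ne_zero
  have h2 : ∀ᵐ p ∂(ν.prod ρ), p.2 ≠ 0 := Measure.quasiMeasurePreserving_snd.ae hρ.ae_ne_zero
  have hexp : ∀ t : ℂ, (fun p : ℝ × ℝ => Complex.exp (t * (Real.log p.1 : ℂ)) *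
      Complex.exp (t * (Real.log p.2 : ℂ))) =ᵐ[ν.prod ρ]
      fun p => Complex.exp (t * (Real.log (p.1 * p.2) : ℂ)) := by
    intro t
    -- Since `Real.log 0 = 0`, additivity of the logarithm needs both factors nonzero; this is why
    -- atoms at `0` are excluded.
    filter_upwards [h1, h2] with p hp1 hp2
    rw [Real.log_mul hp1 hp2, ← Complex.exp_add]
    push_cast; congr 1; ring
  refine ⟨?_, fun t ht => ?_, fun t ht => ?_⟩
  · rw [ae_map_iff hm.aemeasurable measurableSet_ne_zero]
    filter_upwards [h1, h2] with p hp1 hp2 using mul_ne_zero hp1 hp2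
  · rw [integrable_map_measure (measurable_exp_mul_log t).aestronglyMeasurable hm.aemeasurable]
    exact ((hν.integrable t ht).mul_prod (hρ.integrable t ht)).congr (hexp t)
  · rw [integral_map hm.aemeasurable (measurable_exp_mul_log t).aestronglyMeasurable,
      ← integral_congr_ae (hexp t), 
      integral_prod_mul (fun x : ℝ => Complex.exp (t * (Real.log x : ℂ)))
        (fun x : ℝ => Complex.exp (t * (Real.log x : ℂ))), hν.integral_eq t ht, hρ.integral_eq t ht]

lemma hasMomentFunction_dirac {r : ℝ} (hr : r ≠ 0) :
    HasMomentFunction (Measure.dirac r) fun t => Complex.exp (t * (Real.log r : ℂ)) := by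
  refine ⟨?_, fun t _ => ?_, fun t _ => ?_⟩
  · rw [ae_dirac_iff measurableSet_ne_zero]; exact hr
  · exact integrable_dirac (by simp)
  · rw [integral_dirac]

/-- The Mellin transform of `y ↦ exp (-y² / 2)`. -/
lemma hasMellin_exp_neg_sq_div_two {s : ℂ} (hs : 0 < s.re) :
    HasMellin (fun y : ℝ => (Real.exp (-(y ^ 2 / 2)) : ℂ)) s
      (1 / 2 * Complex.exp (s / 2 * (Real.log 2 : ℂ)) * Complex.Gamma (s / 2)) := by
  have hs2 : 0 < (s / ((2 : ℝ) : ℂ)).re := by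
    rw [Complex.div_ofReal_re]; positivity
  have hconv : MellinConvergent (fun x : ℝ => (Real.exp (-x) : ℂ)) (s / ((2 : ℝ) : ℂ)) := by
    have := Complex.GammaIntegral_convergent hs2
    refine this.congr_fun (fun x _ => ?_) measurableSet_Ioi
    simp [mul_comm]
  -- Scaling by `1/2` and the power substitution `x = y²` reduce the transform to the Gamma integral
  -- at `s/2`.
  have hfun : (fun y : ℝ => (Real.exp (-(y ^ 2 / 2)) : ℂ)) = fun y : ℝ =>
      (fun x : ℝ => (fun z : ℝ => (Real.exp (-z) : ℂ)) ((1 / 2) * x)) (y ^ (2 : ℝ)) := by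
    ext y
    simp only [Real.rpow_two]
    congr 3; ring
  rw [hfun]
  constructor
  · exact (MellinConvergent.comp_rpow (f := fun x : ℝ => (Real.exp (-(1 / 2 * x)) : ℂ))
      two_ne_zero).mpr ((MellinConvergent.comp_mul_left (f := fun z : ℝ => (Real.exp (-z) : ℂ))
        (by norm_num)).mpr hconv)
  · refine (mellin_comp_rpow (fun x : ℝ => (Real.exp (-(1 / 2 * x)) : ℂ)) s 2).trans ?_
    rw [mellin_comp_mul_left (fun z : ℝ => (Real.exp (-z) : ℂ)) _ (by norm_num),
      ← Complex.GammaIntegral_eq_mellin, ← Complex.Gamma_eq_integral hs2,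
      Complex.cpow_def_of_ne_zero (by norm_num), ← Complex.ofReal_log (by norm_num)]
    rw [show (1 / 2 : ℝ) = 2⁻¹ by norm_num, Real.log_inv]
    simp only [abs_of_pos (two_pos : (0 : ℝ) < 2), smul_eq_mul, Complex.real_smul]
    push_cast
    rw [mul_assoc]
    congr 3
    · norm_num
    · ring

section
variable {E : Type*} [NormedAddCommGroup E] [InnerProductSpace ℝ E] [FiniteDimensional ℝ E]
  [MeasurableSpace E] [BorelSpace E]

/-- Both sides are finite measures with the same characteristic function, by the Gaussian Fourier
integral. The density opens the way to polar coordinates. -/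
lemma withDensity_exp_neg_norm_sq_eq_smul_stdGaussian :
    ∃ Z : ℝ≥0∞, Z ≠ 0 ∧ Z ≠ ∞ ∧
      (volume : Measure E).withDensity (fun x => ENNReal.ofReal (Real.exp (-(‖x‖ ^ 2 / 2)))) =
        Z • stdGaussian E := by
  set Z : ℝ := (2 * Real.pi) ^ ((Module.finrank ℝ E : ℝ) / 2) with hZ
  have hZ0 : 0 < Z := by positivity
  have hmeas : Measurable fun x : E => ENNReal.ofReal (Real.exp (-(‖x‖ ^ 2 / 2))) := by fun_prop
  have hint : Integrable (fun x : E => Real.exp (-(‖x‖ ^ 2 / 2))) := by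
    have := (GaussianFourier.integrable_cexp_neg_mul_sq_norm_add (V := E) (b := 1 / 2)
      (by norm_num) 0 0).norm
    refine this.congr (ae_of_all _ fun x => ?_)
    simp only [Complex.norm_exp]
    congr 1
    rw [← Complex.ofReal_pow]
    simp only [zero_mul, add_zero]
    rw [show (-(1 / 2) : ℂ) = ((-(1 / 2) : ℝ) : ℂ) by push_cast; rfl, ← Complex.ofReal_mul,
      Complex.ofReal_re]
    ring
  have hfin : IsFiniteMeasure ((volume : Measure E).withDensity
      fun x => ENNReal.ofReal (Real.exp (-(‖x‖ ^ 2 / 2)))) :=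
    isFiniteMeasure_withDensity_ofReal hint.2
  have hfin2 : IsFiniteMeasure (ENNReal.ofReal Z • stdGaussian E) :=
    Measure.smul_finite _ ENNReal.ofReal_ne_top
  refine ⟨ENNReal.ofReal Z, by simpa using hZ0, ENNReal.ofReal_ne_top, ?_⟩
  apply Measure.ext_of_charFun
  ext t
  have h1 : charFun (ENNReal.ofReal Z • stdGaussian E) t = Z * Complex.exp (-‖t‖ ^ 2 / 2) := by
    rw [charFun_apply, integral_smul_measure, ← charFun_apply, charFun_stdGaussian,
      ENNReal.toReal_ofReal hZ0.le, Complex.real_smul]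
  rw [h1, charFun_apply, integral_withDensity_eq_integral_toReal_smul hmeas (by simp)]
  have h2 := GaussianFourier.integral_cexp_neg_mul_sq_norm_add (V := E) (b := 1 / 2)
    (by norm_num) Complex.I t
  have h3 : ((2 * Real.pi : ℝ) : ℂ) ^ ((Module.finrank ℝ E : ℂ) / 2) = Z := by
    rw [hZ, Complex.ofReal_cpow (by positivity)]; push_cast; rfl
  rw [show ((Real.pi : ℂ) / (1 / 2)) = ((2 * Real.pi : ℝ) : ℂ) by push_cast; ring, h3] at h2
  convert! h2 using 2
  · ext x
    rw [ENNReal.toReal_ofReal (Real.exp_pos _).le, Complex.real_smul, Complex.ofReal_exp,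
      ← Complex.exp_add, real_inner_comm]
    congr 1; push_cast; ring
  · congr 1; rw [Complex.I_sq]; ring

lemma stdGaussian_singleton_zero [Nontrivial E] : stdGaussian E {0} = 0 := by
  obtain ⟨Z, hZ0, hZt, hZ⟩ := withDensity_exp_neg_norm_sq_eq_smul_stdGaussian (E := E)
  have h1 : (Z • stdGaussian E) {0} = 0 := by
    rw [← hZ, withDensity_apply _ (measurableSet_singleton 0)]
    simp
  simpa [hZ0] using h1

/-- The complex moments of the norm of a standard Gaussian vector. -/
lemma hasMomentFunction_norm_stdGaussian [Nontrivial E] :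
    HasMomentFunction ((stdGaussian E).map fun x => ‖x‖) fun t =>
      Complex.exp (t / 2 * (Real.log 2 : ℂ)) * (Complex.Gamma ((Module.finrank ℝ E + t) / 2) /
        Complex.Gamma (Module.finrank ℝ E / 2)) := by
  set n := Module.finrank ℝ E with hn
  have hn1 : 1 ≤ n := Module.finrank_pos
  have hn1' : (1 : ℝ) ≤ n := by exact_mod_cast hn1
  have hm : Measurable fun x : E => ‖x‖ := by fun_prop
  obtain ⟨Z, hZ0, hZt, hZ⟩ := withDensity_exp_neg_norm_sq_eq_smul_stdGaussian (E := E)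
  have hmeas : Measurable fun x : E => ENNReal.ofReal (Real.exp (-(‖x‖ ^ 2 / 2))) := by fun_prop
  -- The radial integral in polar coordinates is a Mellin transform at `n + t`, whose real part is
  -- positive because `n ≥ 1`.
  have hrad : ∀ t : ℂ, -1 < t.re →
      IntegrableOn (fun y : ℝ => y ^ (n - 1) • (Real.exp (-(y ^ 2 / 2)) •
        Complex.exp (t * (Real.log y : ℂ)))) (Ioi 0) ∧
      ∫ y in Ioi (0 : ℝ), y ^ (n - 1) • (Real.exp (-(y ^ 2 / 2)) •
        Complex.exp (t * (Real.log y : ℂ))) =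
        1 / 2 * Complex.exp ((n + t) / 2 * (Real.log 2 : ℂ)) * Complex.Gamma ((n + t) / 2) := by
    intro t ht
    obtain ⟨hc, hv⟩ := hasMellin_exp_neg_sq_div_two (s := n + t)
      (by simp; linarith)
    have hcongr : ∀ y ∈ Ioi (0 : ℝ), (y : ℂ) ^ ((n : ℂ) + t - 1) • (Real.exp (-(y ^ 2 / 2)) : ℂ) =
        y ^ (n - 1) • (Real.exp (-(y ^ 2 / 2)) • Complex.exp (t * (Real.log y : ℂ))) := by
      intro y hy
      have hy0 : (y : ℂ) ≠ 0 := by exact_mod_cast (ne_of_gt hy : y ≠ 0)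
      rw [show (n : ℂ) + t - 1 = ((n - 1 : ℕ) : ℂ) + t by push_cast [hn1]; ring,
        Complex.cpow_add _ _ hy0, Complex.cpow_natCast, Complex.cpow_def_of_ne_zero hy0,
        ← Complex.ofReal_log (le_of_lt hy)]
      simp only [smul_eq_mul, Complex.real_smul]
      push_cast
      rw [mul_comm t]; ring
    exact ⟨hc.congr_fun hcongr measurableSet_Ioi,
      (setIntegral_congr_fun measurableSet_Ioi hcongr).symm.trans hv⟩
  set c : ℂ := (Z.toReal : ℂ)⁻¹ * (n * ((volume : Measure E).real (Metric.ball 0 1) : ℂ)) with hc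
  have hmain : ∀ t : ℂ, -1 < t.re →
      Integrable (fun x : ℝ => Complex.exp (t * (Real.log x : ℂ)))
        ((stdGaussian E).map fun x => ‖x‖) ∧
      ∫ x : ℝ, Complex.exp (t * (Real.log x : ℂ)) ∂((stdGaussian E).map fun x => ‖x‖) =
        c * (1 / 2 * Complex.exp ((n + t) / 2 * (Real.log 2 : ℂ)) * Complex.Gamma ((n + t) / 2)) := by
    intro t ht
    obtain ⟨hi, hv⟩ := hrad t ht
    constructor
    · rw [integrable_map_measure (measurable_exp_mul_log t).aestronglyMeasurable hm.aemeasurable,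
        ← integrable_smul_measure hZ0 hZt, ← hZ,
        integrable_withDensity_iff_integrable_smul' hmeas (by simp)]
      have := (integrable_fun_norm_addHaar (volume : Measure E)).mpr hi
      refine this.congr (ae_of_all _ fun x => ?_)
      simp only [Function.comp]
      rw [ENNReal.toReal_ofReal (Real.exp_pos _).le]
    · rw [integral_map hm.aemeasurable (measurable_exp_mul_log t).aestronglyMeasurable]
      have h1 : stdGaussian E = Z⁻¹ • (volume : Measure E).withDensity
          (fun x => ENNReal.ofReal (Real.exp (-(‖x‖ ^ 2 / 2)))) := by
        rw [hZ, smul_smul, ENNReal.inv_mul_cancel hZ0 hZt, one_smul]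
      rw [h1, integral_smul_measure, integral_withDensity_eq_integral_toReal_smul hmeas (by simp)]
      have h2 := integral_fun_norm_addHaar (volume : Measure E) fun y : ℝ =>
        Real.exp (-(y ^ 2 / 2)) • Complex.exp (t * (Real.log y : ℂ))
      rw [hv] at h2
      simp_rw [ENNReal.toReal_ofReal (Real.exp_pos _).le]
      rw [h2, hc, ENNReal.toReal_inv, Complex.real_smul, Complex.real_smul, nsmul_eq_mul]
      push_cast
      ring
  have hΓ : Complex.Gamma ((n : ℂ) / 2) ≠ 0 := by
    apply Complex.Gamma_ne_zero_of_re_pos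
    rw [show ((n : ℂ) / 2) = ((n / 2 : ℝ) : ℂ) by push_cast; rfl, Complex.ofReal_re]
    positivity
  have hprob : IsProbabilityMeasure ((stdGaussian E).map fun x => ‖x‖) :=
    Measure.isProbabilityMeasure_map hm.aemeasurable
  -- The constant `c` is never evaluated: total mass `1` at `t = 0` determines it.
  have h0 := (hmain 0 (by simp)).2
  simp only [zero_mul, Complex.exp_zero, integral_const, probReal_univ, one_smul, add_zero] at h0
  refine ⟨?_, fun t ht => (hmain t ht).1, fun t ht => ?_⟩
  · rw [ae_map_iff hm.aemeasurable measurableSet_ne_zero, ae_iff]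
    simpa using stdGaussian_singleton_zero (E := E)
  · rw [(hmain t ht).2, add_div, add_mul, Complex.exp_add, ← add_div, ← mul_div_assoc, eq_div_iff hΓ]
    linear_combination -(Complex.exp (t / 2 * (Real.log 2 : ℂ)) * Complex.Gamma ((n + t) / 2)) * h0

end

/-! ### Gaussian determinants. -/

/-- The absolute value of the determinant with rows `Y 0, …, Y (n - 1)`. -/
noncomputable def absDet {n : ℕ} (Y : Fin n → EuclideanSpace ℝ (Fin n)) : ℝ :=
  |(Matrix.of fun j i => Y j i).det|

/-- The projection of `ℝ^(m + 1)` to the last `m` coordinates. -/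
noncomputable def euclideanTail {m : ℕ} (x : EuclideanSpace ℝ (Fin (m + 1))) :
    EuclideanSpace ℝ (Fin m) :=
  WithLp.toLp 2 fun i => x i.succ

lemma continuous_absDet {n : ℕ} : Continuous (absDet (n := n)) := by
  unfold absDet
  refine (Continuous.matrix_det ?_).abs
  fun_prop

lemma measurable_euclideanTail {m : ℕ} : Measurable (euclideanTail (m := m)) := by
  unfold euclideanTail; fun_prop

lemma absDet_eq_abs_basis_det {n : ℕ} (Y : Fin n → EuclideanSpace ℝ (Fin n)) :
    absDet Y = |(EuclideanSpace.basisFun (Fin n) ℝ).toBasis.det Y| := by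
  rw [absDet, Module.Basis.det_apply, ← Matrix.det_transpose]
  congr 2

lemma absDet_isometry {n : ℕ} (O : EuclideanSpace ℝ (Fin n) ≃ₗᵢ[ℝ] EuclideanSpace ℝ (Fin n))
    (Y : Fin n → EuclideanSpace ℝ (Fin n)) : absDet (fun j => O (Y j)) = absDet Y := by
  rw [absDet_eq_abs_basis_det, absDet_eq_abs_basis_det]
  have h2 := (EuclideanSpace.basisFun (Fin n) ℝ).toBasis.det_comp
    (O.toLinearEquiv : EuclideanSpace ℝ (Fin n) →ₗ[ℝ] EuclideanSpace ℝ (Fin n)) Y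
  have h3 : |LinearMap.det (O.toLinearEquiv :
      EuclideanSpace ℝ (Fin n) →ₗ[ℝ] EuclideanSpace ℝ (Fin n))| = 1 := by
    -- An isometry maps the unit ball onto itself, so its volume scaling factor `|det O|` is `1`.
    have h4 := Measure.addHaar_image_linearMap (volume : Measure (EuclideanSpace ℝ (Fin n)))
      (O.toLinearEquiv : EuclideanSpace ℝ (Fin n) →ₗ[ℝ] EuclideanSpace ℝ (Fin n))
      (Metric.ball 0 1)
    have h5 : (O.toLinearEquiv : EuclideanSpace ℝ (Fin n) →ₗ[ℝ] EuclideanSpace ℝ (Fin n)) ''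
        (Metric.ball 0 1) = Metric.ball 0 1 := by
      simp
    rw [h5] at h4
    have h6 : volume (Metric.ball (0 : EuclideanSpace ℝ (Fin n)) 1) ≠ 0 :=
      (Metric.measure_ball_pos _ _ one_pos).ne'
    have h7 : volume (Metric.ball (0 : EuclideanSpace ℝ (Fin n)) 1) ≠ ∞ := measure_ball_lt_top.ne
    have h8 := (ENNReal.eq_div_iff h6 h7).mpr ((mul_comm _ _).trans h4.symm)
    rw [ENNReal.div_self h6 h7, ENNReal.ofReal_eq_one] at h8
    exact h8
  have h9 : (⇑(O.toLinearEquiv : EuclideanSpace ℝ (Fin n) →ₗ[ℝ] EuclideanSpace ℝ (Fin n)) ∘ Y) =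
      fun j => O (Y j) := rfl
  rw [← h9, h2, abs_mul, h3, one_mul]

lemma absDet_cons_single {m : ℕ} (r : ℝ) (Z : Fin m → EuclideanSpace ℝ (Fin (m + 1))) :
    absDet (Fin.cons (EuclideanSpace.single 0 r) Z) = |r| * absDet fun j => euclideanTail (Z j) := by
  rw [absDet, Matrix.det_succ_row_zero, Fin.sum_univ_succ, Finset.sum_eq_zero]
  · simp only [Matrix.of_apply, Fin.cons_zero, Fin.val_zero, pow_zero, one_mul, add_zero, abs_mul]
    congr 1
  · intro i _
    simp

lemma map_head_tail_pi {α : Type*} [MeasurableSpace α] (μ : Measure α) [IsProbabilityMeasure μ]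
    (m : ℕ) : (Measure.pi fun _ : Fin (m + 1) => μ).map (fun Y => (Y 0, fun j : Fin m => Y j.succ)) =
      μ.prod (Measure.pi fun _ : Fin m => μ) :=
  (measurePreserving_piFinSuccAbove (fun _ : Fin (m + 1) => μ) 0).map_eq

lemma map_euclideanTail_stdGaussian (m : ℕ) :
    (stdGaussian (EuclideanSpace ℝ (Fin (m + 1)))).map euclideanTail =
      stdGaussian (EuclideanSpace ℝ (Fin m)) := by
  rw [← map_pi_eq_stdGaussian, ← map_pi_eq_stdGaussian,
    Measure.map_map measurable_euclideanTail (by fun_prop)]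
  have h : Measure.map Prod.snd ((gaussianReal 0 1).prod
      (Measure.pi fun _ : Fin m => gaussianReal 0 1)) = Measure.pi fun _ : Fin m => gaussianReal 0 1 :=
    measurePreserving_snd.map_eq
  rw [← h, ← map_head_tail_pi, Measure.map_map (by fun_prop) (by fun_prop),
    Measure.map_map (by fun_prop) (by fun_prop)]
  rfl

/-- Two vectors of equal norm are exchanged by the reflection in the hyperplane orthogonal to their
difference. -/
lemma exists_isometry_single_norm {m : ℕ} (a : EuclideanSpace ℝ (Fin (m + 1))) :
    ∃ O : EuclideanSpace ℝ (Fin (m + 1)) ≃ₗᵢ[ℝ] EuclideanSpace ℝ (Fin (m + 1)),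
      O (EuclideanSpace.single 0 ‖a‖) = a :=
  ⟨_, Submodule.reflection_sub (by simp)⟩

/-- The law of the absolute determinant of an `n × n` matrix with independent standard normal
entries. -/
noncomputable def gaussianDetLaw (n : ℕ) : Measure ℝ :=
  (Measure.pi fun _ : Fin n => stdGaussian (EuclideanSpace ℝ (Fin n))).map absDet

instance (n : ℕ) : IsProbabilityMeasure (gaussianDetLaw n) :=
  Measure.isProbabilityMeasure_map continuous_absDet.measurable.aemeasurable

lemma measurable_absDet_cons {m : ℕ} :
    Measurable fun p : EuclideanSpace ℝ (Fin (m + 1)) × (Fin m → EuclideanSpace ℝ (Fin (m + 1))) =>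
      absDet (Fin.cons p.1 p.2 : Fin (m + 1) → EuclideanSpace ℝ (Fin (m + 1))) := by
  refine (continuous_absDet.comp ?_).measurable
  refine continuous_pi fun j => Fin.cases ?_ (fun i => ?_) j
  · simpa using continuous_fst
  · simp only [Fin.cons_succ]; fun_prop

/-- If one row `a` is fixed and the others are independent standard normal vectors, the absolute
determinant is distributed as `‖a‖` times a Gaussian determinant of smaller size. -/
lemma map_absDet_cons {m : ℕ} (a : EuclideanSpace ℝ (Fin (m + 1))) :
    (Measure.pi fun _ : Fin m => stdGaussian (EuclideanSpace ℝ (Fin (m + 1)))).map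
      (fun Y => absDet (Fin.cons a Y : Fin (m + 1) → EuclideanSpace ℝ (Fin (m + 1)))) =
    (gaussianDetLaw m).map fun d => ‖a‖ * d := by
  obtain ⟨O, hO⟩ := exists_isometry_single_norm a
  have h1 : (Measure.pi fun _ : Fin m => stdGaussian (EuclideanSpace ℝ (Fin (m + 1)))).map
      (fun Z j => O (Z j)) =
      Measure.pi fun _ : Fin m => stdGaussian (EuclideanSpace ℝ (Fin (m + 1))) := by
    rw [Measure.pi_map_pi (f := fun _ => ⇑O) (fun _ => O.continuous.measurable.aemeasurable)]
    simp_rw [stdGaussian_map]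
  have h2 : (Measure.pi fun _ : Fin m => stdGaussian (EuclideanSpace ℝ (Fin (m + 1)))).map
      (fun Z j => euclideanTail (Z j)) =
      Measure.pi fun _ : Fin m => stdGaussian (EuclideanSpace ℝ (Fin m)) := by
    rw [Measure.pi_map_pi (f := fun _ => euclideanTail)
      (fun _ => measurable_euclideanTail.aemeasurable)]
    simp_rw [map_euclideanTail_stdGaussian]
  have hm1 : Measurable fun Y : Fin m → EuclideanSpace ℝ (Fin (m + 1)) =>
      absDet (Fin.cons a Y : Fin (m + 1) → EuclideanSpace ℝ (Fin (m + 1))) :=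
    measurable_absDet_cons.comp measurable_prodMk_left
  have hO' : Measurable fun (Z : Fin m → EuclideanSpace ℝ (Fin (m + 1))) j => O (Z j) :=
    measurable_pi_iff.mpr fun j => O.continuous.measurable.comp (measurable_pi_apply j)
  have ht : Measurable fun (Z : Fin m → EuclideanSpace ℝ (Fin (m + 1))) j => euclideanTail (Z j) :=
    measurable_pi_iff.mpr fun j => measurable_euclideanTail.comp (measurable_pi_apply j)
  -- Rotating the random rows by `O` does not change their law; then `O` is pulled out of all rows
  -- at once, leaving `‖a‖` times the first basis vector on top.
  conv_lhs => rw [← h1]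
  rw [gaussianDetLaw, ← h2, Measure.map_map hm1 hO',
    Measure.map_map continuous_absDet.measurable ht,
    Measure.map_map (measurable_const_mul _) (continuous_absDet.measurable.comp ht)]
  congr 1
  ext Z
  simp only [Function.comp]
  have h3 : (Fin.cons a fun j => O (Z j) : Fin (m + 1) → EuclideanSpace ℝ (Fin (m + 1))) =
      fun j => O ((Fin.cons (EuclideanSpace.single 0 ‖a‖) Z :
        Fin (m + 1) → EuclideanSpace ℝ (Fin (m + 1))) j) := by
    ext j : 1
    refine Fin.cases ?_ (fun i => ?_) j
    · simp [hO]
    · simp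
  rw [h3, absDet_isometry, absDet_cons_single, abs_norm]

/-- Given the first row `a`, the conditional law from `map_absDet_cons` depends on `a` only through
`‖a‖`. Integrating over `a` makes norm and smaller determinant independent. -/
lemma gaussianDetLaw_succ (m : ℕ) : gaussianDetLaw (m + 1) =
    (((stdGaussian (EuclideanSpace ℝ (Fin (m + 1)))).map fun x => ‖x‖).prod
      (gaussianDetLaw m)).map fun p => p.1 * p.2 := by
  have hn : Measurable fun x : EuclideanSpace ℝ (Fin (m + 1)) => ‖x‖ := by fun_prop
  have h1 : gaussianDetLaw (m + 1) = ((stdGaussian (EuclideanSpace ℝ (Fin (m + 1)))).prod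
      (Measure.pi fun _ : Fin m => stdGaussian (EuclideanSpace ℝ (Fin (m + 1))))).map
        fun p => absDet (Fin.cons p.1 p.2 : Fin (m + 1) → EuclideanSpace ℝ (Fin (m + 1))) := by
    rw [← map_head_tail_pi, Measure.map_map measurable_absDet_cons (by fun_prop), gaussianDetLaw]
    congr 1
    ext Y
    exact congrArg absDet (Fin.cons_self_tail Y).symm
  have h2 : ((stdGaussian (EuclideanSpace ℝ (Fin (m + 1)))).map fun x => ‖x‖).prod
      (gaussianDetLaw m) = ((stdGaussian (EuclideanSpace ℝ (Fin (m + 1)))).prod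
        (gaussianDetLaw m)).map fun p => (‖p.1‖, p.2) := by
    have := Measure.map_prod_map (stdGaussian (EuclideanSpace ℝ (Fin (m + 1)))) (gaussianDetLaw m)
      hn measurable_id
    rw [Measure.map_id] at this
    exact this
  rw [h1, h2, Measure.map_map (by fun_prop) (by fun_prop)]
  ext s hs
  have hm2 : Measurable ((fun p : ℝ × ℝ => p.1 * p.2) ∘
      fun p : EuclideanSpace ℝ (Fin (m + 1)) × ℝ => (‖p.1‖, p.2)) := by fun_prop
  rw [Measure.map_apply measurable_absDet_cons hs, Measure.map_apply hm2 hs,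
    Measure.prod_apply (measurable_absDet_cons hs), Measure.prod_apply (hm2 hs)]
  refine lintegral_congr fun a => ?_
  have h4 := congrArg (fun μ : Measure ℝ => μ s) (map_absDet_cons a)
  have hm3 : Measurable fun Y : Fin m → EuclideanSpace ℝ (Fin (m + 1)) =>
      absDet (Fin.cons a Y : Fin (m + 1) → EuclideanSpace ℝ (Fin (m + 1))) :=
    measurable_absDet_cons.comp measurable_prodMk_left
  simp only at h4
  rw [Measure.map_apply hm3 hs,
    Measure.map_apply (measurable_const_mul _) hs] at h4
  exact h4

/-- The complex moments of a Gaussian determinant. -/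
lemma hasMomentFunction_gaussianDetLaw (n : ℕ) : HasMomentFunction (gaussianDetLaw n) fun t =>
    Complex.exp (n * (t / 2) * (Real.log 2 : ℂ)) *
      ∏ j ∈ Finset.range n, Complex.Gamma ((j + 1 + t) / 2) / Complex.Gamma ((j + 1) / 2) := by
  induction n with
  | zero =>
    have h : gaussianDetLaw 0 = Measure.dirac 1 := by
      rw [gaussianDetLaw]
      have : absDet (n := 0) = fun _ => 1 := by ext Y; simp [absDet]
      rw [this, Measure.map_const]; simp
    rw [h]
    simpa using hasMomentFunction_dirac (one_ne_zero (α := ℝ))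
  | succ n ih =>
    have : IsProbabilityMeasure
        ((stdGaussian (EuclideanSpace ℝ (Fin (n + 1)))).map fun x => ‖x‖) :=
      Measure.isProbabilityMeasure_map (by fun_prop)
    rw [gaussianDetLaw_succ]
    have h := (hasMomentFunction_norm_stdGaussian (E := EuclideanSpace ℝ (Fin (n + 1)))).mul ih
    convert! h using 1
    ext t
    rw [Finset.prod_range_succ, finrank_euclideanSpace, Fintype.card_fin,
      show ((n + 1 : ℕ) : ℂ) * (t / 2) * (Real.log 2 : ℂ) =
        t / 2 * (Real.log 2 : ℂ) + n * (t / 2) * (Real.log 2 : ℂ) by push_cast; ring, Complex.exp_add]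
    push_cast
    ring

/-! ### From points to coordinate rows, and the simplex volume as a determinant. -/

lemma map_transpose_pi {μ : Measure ℝ} [IsProbabilityMeasure μ] (m n : ℕ) :
    (Measure.pi fun _ : Fin m => Measure.pi fun _ : Fin n => μ).map (fun f j i => f i j) =
      Measure.pi fun _ : Fin n => Measure.pi fun _ : Fin m => μ := by
  have h1 : ∀ a b : ℕ, (Measure.pi fun _ : Fin a × Fin b => μ).map
      (MeasurableEquiv.curry (Fin a) (Fin b) ℝ) =
      Measure.pi fun _ : Fin a => Measure.pi fun _ : Fin b => μ := by
    intro a b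
    have := Measure.infinitePi_map_curry (ι := Fin a) (κ := Fin b) (fun _ _ => μ)
    simpa only [Measure.infinitePi_eq_pi] using this
  have h2 := (measurePreserving_piCongrLeft (fun _ : Fin n × Fin m => μ)
    (Equiv.prodComm (Fin m) (Fin n))).map_eq
  rw [← h1 m n, ← h1 n m, ← h2, Measure.map_map (by fun_prop) (MeasurableEquiv.measurable _),
    Measure.map_map (MeasurableEquiv.measurable _) (MeasurableEquiv.measurable _)]
  congr 1

lemma map_transpose_stdGaussian (m n : ℕ) :
    (Measure.pi fun _ : Fin m => stdGaussian (EuclideanSpace ℝ (Fin n))).map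
      (fun X j => WithLp.toLp 2 fun i => X i j) =
      Measure.pi fun _ : Fin n => stdGaussian (EuclideanSpace ℝ (Fin m)) := by
  have h : ∀ a b : ℕ, (Measure.pi fun _ : Fin a => Measure.pi fun _ : Fin b => gaussianReal 0 1).map
      (fun f i => WithLp.toLp 2 (f i)) =
      Measure.pi fun _ : Fin a => stdGaussian (EuclideanSpace ℝ (Fin b)) := by
    intro a b
    rw [Measure.pi_map_pi (f := fun _ => WithLp.toLp 2) (fun _ => by fun_prop)]
    simp_rw [map_pi_eq_stdGaussian]
  rw [← h m n, ← h n m, ← map_transpose_pi m n, Measure.map_map (by fun_prop) (by fun_prop),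
    Measure.map_map (by fun_prop) (by fun_prop)]
  rfl

/-- The simplex `{y : y i ≥ 0, ∑ i, y i ≤ s}`. -/
def cornerSimplex (n : ℕ) (s : ℝ) : Set (Fin n → ℝ) := {y | (∀ i, 0 ≤ y i) ∧ ∑ i, y i ≤ s}

lemma measurableSet_cornerSimplex (n : ℕ) (s : ℝ) : MeasurableSet (cornerSimplex n s) := by
  have : cornerSimplex n s = (⋂ i, {y | 0 ≤ y i}) ∩ {y | ∑ i, y i ≤ s} := by
    ext y; simp [cornerSimplex]
  rw [this]
  exact (MeasurableSet.iInter fun i => measurableSet_le (by fun_prop) (by fun_prop)).inter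
    (measurableSet_le (by fun_prop) (by fun_prop))

lemma convex_cornerSimplex (n : ℕ) (s : ℝ) : Convex ℝ (cornerSimplex n s) := by
  intro y hy z hz a b ha hb hab
  refine ⟨fun i => ?_, ?_⟩
  · have := mul_nonneg ha (hy.1 i)
    have := mul_nonneg hb (hz.1 i)
    simp only [Pi.add_apply, Pi.smul_apply, smul_eq_mul]
    linarith
  · simp only [Pi.add_apply, Pi.smul_apply, smul_eq_mul, Finset.sum_add_distrib, ← Finset.mul_sum]
    calc _ ≤ a * s + b * s := by gcongr; exacts [hy.2, hz.2]
      _ = s := by rw [← add_mul, hab, one_mul]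

/-- The slice at first coordinate `x` is a corner simplex of size `s - x`. The size is therefore a
variable in the induction, and the integral of `(s - x)^n / n!` over `[0, s]` closes it. -/
lemma volume_cornerSimplex (n : ℕ) (s : ℝ) (hs : 0 ≤ s) :
    volume (cornerSimplex n s) = ENNReal.ofReal (s ^ n / n.factorial) := by
  induction n generalizing s with
  | zero =>
    have : cornerSimplex 0 s = univ := by ext y; simp [cornerSimplex, hs]
    rw [this, volume_pi]; simp
  | succ n ih =>
    have h := (volume_preserving_piFinSuccAbove (fun _ : Fin (n + 1) => ℝ) 0)
    have hset : cornerSimplex (n + 1) s = MeasurableEquiv.piFinSuccAbove (fun _ : Fin (n + 1) => ℝ) 0 ⁻¹'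
        {p : ℝ × (Fin n → ℝ) | 0 ≤ p.1 ∧ p.2 ∈ cornerSimplex n (s - p.1)} := by
      ext y
      change _ ↔ 0 ≤ y 0 ∧ (fun i : Fin n => y i.succ) ∈ cornerSimplex n (s - y 0)
      simp only [cornerSimplex, mem_ofPred_eq, Fin.forall_fin_succ, Fin.sum_univ_succ, and_assoc,
        le_sub_iff_add_le']
    have hmeas : MeasurableSet {p : ℝ × (Fin n → ℝ) | 0 ≤ p.1 ∧ p.2 ∈ cornerSimplex n (s - p.1)} := by
      have : {p : ℝ × (Fin n → ℝ) | 0 ≤ p.1 ∧ p.2 ∈ cornerSimplex n (s - p.1)} =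
          {p | 0 ≤ p.1} ∩ ((⋂ i, {p | 0 ≤ p.2 i}) ∩ {p | ∑ i, p.2 i ≤ s - p.1}) := by
        ext p; simp [cornerSimplex]
      rw [this]
      exact (measurableSet_le (by fun_prop) (by fun_prop)).inter
        ((MeasurableSet.iInter fun i => measurableSet_le (by fun_prop) (by fun_prop)).inter
          (measurableSet_le (by fun_prop) (by fun_prop)))
    have hslice : ∀ x : ℝ, volume (Prod.mk x ⁻¹'
        {p : ℝ × (Fin n → ℝ) | 0 ≤ p.1 ∧ p.2 ∈ cornerSimplex n (s - p.1)}) =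
        (Icc 0 s).indicator (fun x => ENNReal.ofReal ((s - x) ^ n / n.factorial)) x := by
      intro x
      by_cases hx : x ∈ Icc 0 s
      · rw [indicator_of_mem hx, ← ih (s - x) (by linarith [hx.2])]
        congr 1
        ext y
        simp [hx.1]
      · rw [indicator_of_notMem hx]
        convert measure_empty (μ := (volume : Measure (Fin n → ℝ)))
        ext y
        simp only [mem_preimage, mem_ofPred_eq, mem_empty_iff_false, iff_false, not_and]
        intro hx0 hy
        have := Finset.sum_nonneg fun i (_ : i ∈ Finset.univ) => hy.1 i
        exact hx ⟨hx0, by linarith [hy.2]⟩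
    rw [hset, h.measure_preimage hmeas.nullMeasurableSet, Measure.volume_eq_prod,
      Measure.prod_apply hmeas, lintegral_congr hslice, lintegral_indicator measurableSet_Icc,
      ← ofReal_integral_eq_lintegral_ofReal]
    · rw [integral_Icc_eq_integral_Ioc, ← intervalIntegral.integral_of_le hs,
        intervalIntegral.integral_div, intervalIntegral.integral_comp_sub_left (fun x => x ^ n),
        integral_pow, Nat.factorial_succ]
      congr 1
      push_cast
      simp
      field_simp
    · exact (Continuous.continuousOn (by fun_prop)).integrableOn_Icc
    · rw [EventuallyLE, ae_restrict_iff' measurableSet_Icc]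
      refine ae_of_all _ fun x hx => ?_
      have : 0 ≤ s - x := by linarith [hx.2]
      simp only [Pi.zero_apply]
      positivity

/-- The linear map sending the standard basis to the edge vectors at the vertex `x 0`. -/
noncomputable def edgeMap {n : ℕ} (x : Fin (n + 1) → EuclideanSpace ℝ (Fin n)) :
    EuclideanSpace ℝ (Fin n) →ₗ[ℝ] EuclideanSpace ℝ (Fin n) :=
  (EuclideanSpace.basisFun (Fin n) ℝ).toBasis.constr ℝ fun i => x i.succ - x 0

lemma edgeMap_apply {n : ℕ} (x : Fin (n + 1) → EuclideanSpace ℝ (Fin n))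
    (z : EuclideanSpace ℝ (Fin n)) : edgeMap x z = ∑ i, z i • (x i.succ - x 0) := by
  rw [edgeMap, Module.Basis.constr_apply_fintype]
  simp

lemma abs_det_edgeMap {n : ℕ} (x : Fin (n + 1) → EuclideanSpace ℝ (Fin n)) :
    |LinearMap.det (edgeMap x)| = absDet fun i => x i.succ - x 0 := by
  have h := (EuclideanSpace.basisFun (Fin n) ℝ).toBasis.det_comp (edgeMap x)
    (EuclideanSpace.basisFun (Fin n) ℝ).toBasis
  rw [Module.Basis.det_self, mul_one] at h
  rw [← h, absDet_eq_abs_basis_det]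
  congr 2
  ext i : 1
  exact (EuclideanSpace.basisFun (Fin n) ℝ).toBasis.constr_basis ℝ (fun i => x i.succ - x 0) i

/-- These are barycentric coordinates, with the remaining weight `1 - ∑ i, z i` at the vertex `x 0`.
No affine independence is required. -/
lemma convexHull_range_eq_image {n : ℕ} (x : Fin (n + 1) → EuclideanSpace ℝ (Fin n)) :
    convexHull ℝ (range x) =
      (fun v => x 0 + v) '' (edgeMap x '' {z | WithLp.ofLp z ∈ cornerSimplex n 1}) := by
  apply Subset.antisymm
  · refine convexHull_min ?_ ?_
    · rintro _ ⟨j, rfl⟩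
      refine Fin.cases ?_ (fun i => ?_) j
      · exact ⟨0, ⟨0, ⟨by simp, by simp⟩, by simp⟩, by simp⟩
      · refine ⟨x i.succ - x 0, ⟨EuclideanSpace.single i 1, ⟨fun k => ?_, ?_⟩, ?_⟩, by simp⟩
        · by_cases h : k = i <;> simp [h]
        · simp
        · simp [edgeMap_apply]
    · have h : Convex ℝ {z : EuclideanSpace ℝ (Fin n) | WithLp.ofLp z ∈ cornerSimplex n 1} :=
        (convex_cornerSimplex n 1).linear_preimage
          (WithLp.linearEquiv 2 ℝ (Fin n → ℝ)).toLinearMap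
      exact (h.linear_image _).translate _
  · rintro _ ⟨_, ⟨z, hz, rfl⟩, rfl⟩
    have h0 : 0 ≤ 1 - ∑ i, z i := sub_nonneg.mpr hz.2
    have h := (convex_convexHull ℝ (range x)).sum_mem (t := Finset.univ)
      (w := (Fin.cons (1 - ∑ i, z i) fun i => z i : Fin (n + 1) → ℝ)) (z := x)
      (fun j _ => Fin.cases (by simpa using h0) (fun i => by simpa using hz.1 i) j)
      (by simp [Fin.sum_univ_succ]) (fun j _ => subset_convexHull ℝ _ (mem_range_self j))
    convert! h using 1
    rw [Fin.sum_univ_succ]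
    simp only [Fin.cons_zero, Fin.cons_succ, edgeMap_apply, smul_sub, Finset.sum_sub_distrib,
      ← Finset.sum_smul, sub_smul, one_smul]
    abel

lemma factorial_mul_simplexVolume {n : ℕ} (x : Fin (n + 1) → EuclideanSpace ℝ (Fin n)) :
    (n.factorial : ℝ) * simplexVolume x = absDet fun i => x i.succ - x 0 := by
  have hpre : volume {z : EuclideanSpace ℝ (Fin n) | WithLp.ofLp z ∈ cornerSimplex n 1} =
      ENNReal.ofReal (1 / n.factorial) := by
    have := (PiLp.volume_preserving_ofLp (Fin n)).measure_preimage
      (measurableSet_cornerSimplex n 1).nullMeasurableSet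
    rw [volume_cornerSimplex n 1 zero_le_one, one_pow] at this
    exact this
  rw [simplexVolume, convexHull_range_eq_image, image_add_left, measure_preimage_add,
    Measure.addHaar_image_linearMap, hpre, abs_det_edgeMap, ENNReal.toReal_mul,
    ENNReal.toReal_ofReal (show 0 ≤ absDet _ from abs_nonneg _),
    ENNReal.toReal_ofReal (by positivity)]
  field_simp

/-- The edge vectors share `x 0` and so are not independent. Bordering the transposed coordinate
matrix by a row of ones restores independence of the random rows; subtracting the data of `x 0` and
expanding recovers the edges. -/
lemma absDet_edges_eq {n : ℕ} (x : Fin (n + 1) → EuclideanSpace ℝ (Fin n)) :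
    (absDet fun i => x i.succ - x 0) =
      absDet (Fin.cons (WithLp.toLp 2 fun _ => 1) (fun j => WithLp.toLp 2 fun i => x i j) :
        Fin (n + 1) → EuclideanSpace ℝ (Fin (n + 1))) := by
  set A : Matrix (Fin (n + 1)) (Fin (n + 1)) ℝ := Matrix.of fun i j =>
    (Fin.cons 1 (fun k => x i k) : Fin (n + 1) → ℝ) j with hA
  set B : Matrix (Fin (n + 1)) (Fin (n + 1)) ℝ := Matrix.of fun i j =>
    if i = 0 then A 0 j else A i j - A 0 j with hB
  have h1 : absDet (Fin.cons (WithLp.toLp 2 fun _ => 1) (fun j => WithLp.toLp 2 fun i => x i j) :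
        Fin (n + 1) → EuclideanSpace ℝ (Fin (n + 1))) = |A.det| := by
    rw [absDet, ← Matrix.det_transpose]
    congr 2
    ext i j
    refine Fin.cases ?_ (fun k => ?_) j <;> simp [hA]
  have h2 : A.det = B.det := by
    refine Matrix.det_eq_of_forall_row_eq_smul_add_const (fun i => if i = 0 then 0 else 1) 0
      (by simp) fun i j => ?_
    by_cases hi : i = 0 <;> simp [hB, hi]
  rw [h1, h2, Matrix.det_succ_column_zero, Fin.sum_univ_succ, Finset.sum_eq_zero]
  · have : B.submatrix (Fin.succAbove 0) Fin.succ = Matrix.of fun i j => (x i.succ - x 0) j := by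
      ext i j
      simp [hB, hA]
    rw [this, absDet]
    simp [hB, hA]
  · intro i _
    simp [hB, hA]

/-! ### Law and moments of the simplex volume. -/

/-- The law of `n!` times the volume of a Gaussian simplex. -/
lemma map_factorial_mul_simplexVolume (n : ℕ) :
    (Measure.pi fun _ : Fin (n + 1) => stdGaussian (EuclideanSpace ℝ (Fin n))).map
      (fun x => (n.factorial : ℝ) * simplexVolume x) =
    (gaussianDetLaw n).map fun d => √(n + 1) * d := by
  have h1 : (fun x : Fin (n + 1) → EuclideanSpace ℝ (Fin n) =>
      (n.factorial : ℝ) * simplexVolume x) =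
      (fun Y => absDet (Fin.cons (WithLp.toLp 2 fun _ => 1) Y :
        Fin (n + 1) → EuclideanSpace ℝ (Fin (n + 1)))) ∘ fun x j => WithLp.toLp 2 fun i => x i j := by
    ext x
    rw [factorial_mul_simplexVolume, absDet_edges_eq]
    rfl
  have h2 : ‖(WithLp.toLp 2 fun _ => 1 : EuclideanSpace ℝ (Fin (n + 1)))‖ = √(n + 1) := by
    simp [EuclideanSpace.norm_eq]
  have hm : Measurable fun Y : Fin n → EuclideanSpace ℝ (Fin (n + 1)) =>
      absDet (Fin.cons (WithLp.toLp 2 fun _ => 1) Y :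
        Fin (n + 1) → EuclideanSpace ℝ (Fin (n + 1))) :=
    measurable_absDet_cons.comp measurable_prodMk_left
  rw [h1, ← Measure.map_map hm (by fun_prop),
    map_transpose_stdGaussian, ← h2]
  exact map_absDet_cons _

lemma hasMomentFunction_simplexVolume (n : ℕ) :
    HasMomentFunction ((gaussianDetLaw n).map fun d => √(n + 1) * d) (simplexMoment n) := by
  have hpos : (0 : ℝ) < n + 1 := by positivity
  have h := (hasMomentFunction_dirac (Real.sqrt_ne_zero'.mpr hpos)).mul
    (hasMomentFunction_gaussianDetLaw n)
  rw [Measure.dirac_prod, Measure.map_map (by fun_prop) (by fun_prop)] at h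
  convert! h using 1
  ext t
  rw [simplexMoment, Real.log_sqrt hpos.le, ← mul_assoc]
  push_cast
  rw [mul_div_assoc' t, div_mul_eq_mul_div t]

lemma measurable_factorial_mul_simplexVolume (n : ℕ) :
    Measurable fun x : Fin (n + 1) → EuclideanSpace ℝ (Fin n) =>
      (n.factorial : ℝ) * simplexVolume x := by
  simp_rw [factorial_mul_simplexVolume]
  exact continuous_absDet.measurable.comp (by fun_prop)

section
variable {Ω : Type*} [MeasurableSpace Ω] {P : Measure Ω} {n : ℕ}
  {X : Fin (n + 1) → Ω → EuclideanSpace ℝ (Fin n)}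

lemma IsGaussianModel.aemeasurable (hX : IsGaussianModel P X) :
    AEMeasurable (fun ω i => X i ω) P :=
  aemeasurable_pi_lambda _ fun i => (hX.hasLaw i).aemeasurable

lemma IsGaussianModel.map_factorial_mul_simplexVolume [IsProbabilityMeasure P]
    (hX : IsGaussianModel P X) :
    P.map (fun ω => (n.factorial : ℝ) * simplexVolume fun i => X i ω) =
      (gaussianDetLaw n).map fun d => √(n + 1) * d := by
  have h := (iIndepFun_iff_map_fun_eq_pi_map fun i => (hX.hasLaw i).aemeasurable).mp hX.indep
  simp_rw [(hX.hasLaw _).map_eq] at h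
  rw [← _root_.map_factorial_mul_simplexVolume, ← h, AEMeasurable.map_map_of_aemeasurable
    (measurable_factorial_mul_simplexVolume n).aemeasurable hX.aemeasurable]
  rfl

lemma IsGaussianModel.aemeasurable_logSimplexVolume (hX : IsGaussianModel P X) :
    AEMeasurable (logSimplexVolume X) P :=
  Real.measurable_log.comp_aemeasurable
    ((measurable_factorial_mul_simplexVolume n).comp_aemeasurable hX.aemeasurable)

lemma IsGaussianModel.integrable_and_integral_eq [IsProbabilityMeasure P]
    (hX : IsGaussianModel P X) {t : ℂ} (ht : -1 < t.re) :
    Integrable (fun ω => Complex.exp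
      (t * ((logSimplexVolume X ω - fullDimCentering n : ℝ) : ℂ))) P ∧
    ∫ ω, Complex.exp (t * ((logSimplexVolume X ω - fullDimCentering n : ℝ) : ℂ)) ∂P =
      centeredMoment n t := by
  have hm := hasMomentFunction_simplexVolume n
  rw [← hX.map_factorial_mul_simplexVolume] at hm
  have hae : AEMeasurable (fun ω => (n.factorial : ℝ) * simplexVolume fun i => X i ω) P :=
    (measurable_factorial_mul_simplexVolume n).comp_aemeasurable hX.aemeasurable
  have hi := hm.integrable t ht
  have hv := hm.integral_eq t ht
  rw [integrable_map_measure (measurable_exp_mul_log t).aestronglyMeasurable hae] at hi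
  rw [integral_map hae (measurable_exp_mul_log t).aestronglyMeasurable] at hv
  have hfun : (fun ω => Complex.exp
      (t * ((logSimplexVolume X ω - fullDimCentering n : ℝ) : ℂ))) =
      fun ω => Complex.exp (-(t * (fullDimCentering n : ℂ))) * Complex.exp
        (t * (Real.log ((n.factorial : ℝ) * simplexVolume fun i => X i ω) : ℂ)) := by
    ext ω
    rw [← Complex.exp_add, logSimplexVolume]
    congr 1; push_cast; ring
  rw [hfun, integral_const_mul, hv]
  exact ⟨hi.const_mul _, rfl⟩

end

/-! ### The Gaussian reference law, the half-plane, and the conclusion. -/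

lemma map_sum_pi_gaussianReal (m : ℕ) (v : ℝ≥0) :
    Measure.map (fun x : Fin m → ℝ => ∑ i, x i) (Measure.pi fun _ => gaussianReal 0 v) =
      gaussianReal 0 (m * v) := by
  induction m with
  | zero =>
    simp only [Finset.univ_eq_empty, Finset.sum_empty, Measure.map_const, measure_univ, one_smul,
      Nat.cast_zero, zero_mul, gaussianReal_zero_var]
  | succ m ih =>
    have h : (fun x : Fin (m + 1) → ℝ => ∑ i, x i) = (fun p : ℝ × (Fin m → ℝ) =>
        p.1 + ∑ i, p.2 i) ∘ fun Y => (Y 0, fun j : Fin m => Y j.succ) := by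
      ext x; simp [Fin.sum_univ_succ]
    have h2 : (fun p : ℝ × (Fin m → ℝ) => p.1 + ∑ i, p.2 i) = (fun q : ℝ × ℝ => q.1 + q.2) ∘
        Prod.map id fun x : Fin m → ℝ => ∑ i, x i := rfl
    rw [h, ← Measure.map_map (by fun_prop) (by fun_prop), map_head_tail_pi, h2,
      ← Measure.map_map (by fun_prop) (by fun_prop), ← Measure.map_prod_map _ _ measurable_id
        (by fun_prop), ih, Measure.map_id]
    have := gaussianReal_conv_gaussianReal (m₁ := 0) (m₂ := 0) (v₁ := v) (v₂ := m * v)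
    rw [Measure.conv] at this
    rw [this]
    congr 1
    · simp
    · push_cast; ring

lemma isInfinitelyDivisible_gaussianReal : IsInfinitelyDivisible (gaussianReal 0 1) := by
  refine ⟨inferInstance, fun m hm => ⟨gaussianReal 0 (m : ℝ≥0)⁻¹, inferInstance, ?_⟩⟩
  rw [map_sum_pi_gaussianReal, mul_inv_cancel₀ (by exact_mod_cast (by omega : m ≠ 0))]

lemma integrable_cexp_mul_gaussianReal (t : ℂ) :
    Integrable (fun x : ℝ => Complex.exp (t * x)) (gaussianReal 0 1) := by
  refine (integrable_exp_mul_gaussianReal (μ := 0) (v := 1) t.re).mono'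
    (by fun_prop) (ae_of_all _ fun x => ?_)
  rw [Complex.norm_exp, Complex.re_mul_ofReal]

lemma integral_cexp_mul_gaussianReal (t : ℂ) :
    ∫ x : ℝ, Complex.exp (t * x) ∂(gaussianReal 0 1) = Complex.exp (t ^ 2 / 2) := by
  have := complexMGF_id_gaussianReal (μ := 0) (v := 1) t
  simpa [complexMGF] using this

lemma mem_verticalStrip_neg_one_top {t : ℂ} : t ∈ verticalStrip (-1) ⊤ ↔ -1 < t.re := by
  have : (-1 : EReal) = ((-1 : ℝ) : EReal) := by simp
  rw [verticalStrip, this, mem_ofPred_eq, EReal.coe_lt_coe_iff]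
  exact and_iff_left (EReal.coe_lt_top _)

lemma verticalStrip_subset_complNegIntegers : verticalStrip (-1) ⊤ ⊆ complNegIntegers := by
  intro t ht k hk
  rw [mem_verticalStrip_neg_one_top, hk] at ht
  simp at ht
  have : (0 : ℝ) ≤ k := by positivity
  linarith

lemma tendsto_fullDimParam : Tendsto fullDimParam atTop atTop := by
  refine Tendsto.const_mul_atTop (by norm_num) (Real.tendsto_log_atTop.comp ?_)
  exact tendsto_natCast_atTop_atTop.atTop_div_const two_pos

theorem mainTheorem10 {Ω : ℕ → Type*} [∀ n, MeasurableSpace (Ω n)] (P : ∀ n, Measure (Ω n))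
    (X : ∀ n, Fin (n + 1) → Ω n → EuclideanSpace ℝ (Fin n))
    (hP : ∀ n, 1 ≤ n → IsProbabilityMeasure (P n))
    (hX : ∀ n, 1 ≤ n → IsGaussianModel (P n) (X n)) :
    -- mod-Gaussian convergence on the half-plane where the moment generating functions exist
    ModGaussianConvergence P (fun n ω => logSimplexVolume (X n) ω - fullDimCentering n)
      (-1) ⊤ fullDimParam fullDimLimit ∧
    -- the limit function is analytic off the negative integers, and the moment generating functions
    -- have meromorphic continuations `M n` that are analytic there and for which the convergence
    -- is uniform on all compact sets avoiding the negative integers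
    AnalyticOnNhd ℂ fullDimLimit complNegIntegers ∧
    ∃ M : ℕ → ℂ → ℂ,
      (∀ n, 1 ≤ n →
        MeromorphicOn (M n) univ ∧
        AnalyticOnNhd ℂ (M n) complNegIntegers ∧
        ∀ t : ℂ, -1 < t.re →
          Integrable (fun ω => Complex.exp
            (t * ((logSimplexVolume (X n) ω - fullDimCentering n : ℝ) : ℂ))) (P n) ∧
          M n t = ∫ ω, Complex.exp
            (t * ((logSimplexVolume (X n) ω - fullDimCentering n : ℝ) : ℂ)) ∂(P n)) ∧
      ∀ K : Set ℂ, IsCompact K → K ⊆ complNegIntegers →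
        TendstoUniformlyOn
          (fun n t => M n t / Complex.exp ((1 / 4) * t ^ 2 * (Real.log ((n : ℝ) / 2) : ℂ)))
          (fun t => barnesG (1 / 2) / (barnesG (1 / 2 + t / 2) * barnesG (1 + t / 2))) atTop K := by

  refine ⟨⟨?_, isInfinitelyDivisible_gaussianReal, fun t _ => integrable_cexp_mul_gaussianReal t,
    fun t _ => integral_cexp_mul_gaussianReal t, fun n hn => ?_, fun n hn t ht => ?_,
    tendsto_fullDimParam, analyticOnNhd_fullDimLimit.mono verticalStrip_subset_complNegIntegers,
    fun K hK hKs => ?_⟩, analyticOnNhd_fullDimLimit, centeredMoment, fun n hn => ?_,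
    fun K hK hKs => tendstoUniformlyOn_centeredMoment hK hKs⟩
  · rw [show (-1 : EReal) = ((-1 : ℝ) : EReal) by simp]
    exact EReal.coe_lt_top _
  · exact (hX n hn).aemeasurable_logSimplexVolume.sub_const _
  · have := hP n hn
    exact ((hX n hn).integrable_and_integral_eq (mem_verticalStrip_neg_one_top.mp ht)).1
  · refine (tendstoUniformlyOn_centeredMoment hK
      (hKs.trans verticalStrip_subset_complNegIntegers)).congr ?_
    -- The model is assumed only for `n ≥ 1`, so the integrals agree with `centeredMoment` only
    -- eventually.
    filter_upwards [eventually_ge_atTop 1] with n hn t ht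
    have := hP n hn
    simp only
    rw [((hX n hn).integrable_and_integral_eq (mem_verticalStrip_neg_one_top.mp (hKs ht))).2,
      fullDimParam]
    congr 2
    push_cast
    ring
  · have := hP n hn
    exact ⟨meromorphicOn_centeredMoment n, analyticOnNhd_centeredMoment n, fun t ht =>
      ⟨((hX n hn).integrable_and_integral_eq ht).1, ((hX n hn).integrable_and_integral_eq ht).2.symm⟩⟩
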